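/- Let $p$ be a prime and $q=p^e$ with $e\ge 1$. A Weil $q$-number is an algebraic integer $\pi$ in a field of characteristic zero such that $|\iota(\pi)|=q^{1/2}$ for every embedding $\iota:\mathbb{Q}(\pi)\hookrightarrow\mathbb{C}$; two Weil $q$-numbers $\pi,\pi'$ are conjugate if there is an isomorphism $\mathbb{Q}(\pi)\cong\mathbb{Q}(\pi')$ carrying $\pi$ to $\pi'$. Let $W_q$ be the set of conjugacy classes of Weil $q$-numbers, and let $P_\pi(x)\in\mathbb{Z}[x]$ be the monic minimal polynomial of $\pi$. For a finite subset $w\subseteq W_q$ with representatives $\pi_1,\dots,\pi_r$, let $R_w$ be the quotient of $\mathbb{Z}[F,V]/(FV-q)$ by the kernel of the ring homomorphism $$\mathbb{Z}[F,V]/(FV-q)\longrightarrow\prod_{i=1}^r\mathbb{Q}(\pi_i),\qquad F\mapsto(\pi_i)_i,\quad V\mapsto(q/\pi_i)_i.$$ For a non-real Weil $q$-number $\pi$ with $P_\pi(x)=x^{2d}+a_{2d-1}x^{2d-1}+\dots+a_0$, set $$h_\pi(F,V)=F^d+a_{2d-1}F^{d-1}+\dots+a_{d+1}F+a_d+a_{d+1}V+\dots+a_{2d-1}V^{d-1}+V^d\in\mathbb{Z}[F,V],$$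 and for $\pi$ real but not rational set $h_\pi(F,V)=F-V$. For a finite set $v\subseteq W_q$ of non-rational classes put $h_v=\prod_{\pi\in v}h_\pi$. The class of $\pi$ is called ordinary if exactly half of the roots of $P_\pi$ in an algebraic closure of $\mathbb{Q}_p$ are $p$-adic units. Suppose that $q=s^2$ for a positive or negative integer $s=\sqrt q$. Let $v\subseteq W_q$ be a finite set containing no rational conjugacy class (that is, neither of the classes of $s$ and $-s$), and set $w=v\cup\{s\}$. Then: (a) $R_w=\mathbb{Z}[F,V]/\bigl(FV-q,\ h_v(F,V)(F-s),\ h_v(F,V)(V-s)\bigr)$; that is, the quotient map $\mathbb{Z}[F,V]\to R_w$ induces an isomorphism from the right-hand side onto $R_w$. (b) The ring $R_w$ is Gorenstein if and only if every conjugacy class in $v$ is ordinary. -/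

import Mathlib

noncomputable section

namespace WeilNumber

open IntermediateField

/-- A Weil `q`-number: an algebraic integer `π` in a field of characteristic zero such that every
embedding of `ℚ(π)` into `ℂ` sends `π` to a complex number of absolute value `√q`. -/
def IsWeilNumber {K : Type*} [Field K] [CharZero K] (q : ℕ) (π : K) : Prop :=
  IsIntegral ℤ π ∧ ∀ ι : ℚ⟮π⟯ →+* ℂ, ‖ι (AdjoinSimple.gen ℚ π)‖ = Real.sqrt q

/-- `π` and `π'` are conjugate if some isomorphism `ℚ(π) ≃ ℚ(π')` carries `π` to `π'`. -/
def IsConjugate {K L : Type*} [Field K] [CharZero K] [Field L] [CharZero L]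
    (π : K) (π' : L) : Prop :=
  ∃ σ : ℚ⟮π⟯ ≃+* ℚ⟮π'⟯, σ (AdjoinSimple.gen ℚ π) = AdjoinSimple.gen ℚ π'

/-- Conjugacy of Weil `q`-numbers. Every Weil `q`-number is conjugate to one in `ℂ`, so it is enough
to consider those. -/
def conjugacy (q : ℕ) : Setoid {π : ℂ // IsWeilNumber q π} where
  r π π' := IsConjugate π.1 π'.1
  iseqv :=
    { refl := fun _ => ⟨RingEquiv.refl _, rfl⟩
      symm := fun ⟨σ, h⟩ => ⟨σ.symm, by rw [← h, RingEquiv.symm_apply_apply]⟩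
      trans := fun ⟨σ, h⟩ ⟨τ, h'⟩ => ⟨σ.trans τ, by rw [RingEquiv.trans_apply, h, h']⟩ }

/-- The set `W_q` of conjugacy classes of Weil `q`-numbers. -/
def WeilClass (q : ℕ) : Type := Quotient (conjugacy q)

/-- A chosen Weil `q`-number representing a given class. -/
def WeilClass.rep {q : ℕ} (c : WeilClass q) : ℂ := (Quotient.out (s := conjugacy q) c).1

theorem isWeilNumber_intCast {q : ℕ} {s : ℤ} (hs : s ^ 2 = (q : ℤ)) :
    IsWeilNumber q (s : ℂ) := by
  refine ⟨by simpa using isIntegral_algebraMap (R := ℤ) (A := ℂ) (x := s), fun ι => ?_⟩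
  have h1 : AdjoinSimple.gen ℚ (s : ℂ) = (s : ℚ⟮(s : ℂ)⟯) := Subtype.ext (by simp)
  rw [h1, map_intCast, Complex.norm_intCast, ← Real.sqrt_sq_eq_abs]
  congr 1
  exact_mod_cast hs

/-- For an integer `s` with `s ^ 2 = q`, the conjugacy class of the rational Weil `q`-number `s`. -/
def WeilClass.ofInt {q : ℕ} (s : ℤ) (hs : s ^ 2 = (q : ℤ)) : WeilClass q :=
  Quotient.mk (conjugacy q) ⟨(s : ℂ), isWeilNumber_intCast hs⟩

/-- The class consists of rational Weil numbers. -/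
def WeilClass.IsRational {q : ℕ} (c : WeilClass q) : Prop :=
  ∃ r : ℚ, c.rep = (r : ℂ)

/-- The normalized minimal polynomial `P_π`, which has integral coefficients. -/
def WeilClass.minpoly {q : ℕ} (c : WeilClass q) : Polynomial ℤ :=
  _root_.minpoly ℤ c.rep

/-- The class is ordinary (for `q` a power of `p`): exactly half of the roots of `P_π` in an
algebraic closure of `ℚ_p` are `p`-adic units. -/
def WeilClass.IsOrdinary (p : ℕ) [Fact p.Prime] {q : ℕ} (c : WeilClass q) : Prop :=
  2 * {α : PadicAlgCl p | Polynomial.aeval α c.minpoly = 0 ∧ ‖α‖ = 1}.ncard =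
    {α : PadicAlgCl p | Polynomial.aeval α c.minpoly = 0}.ncard

/-- The polynomial ring `ℤ[F, V]`. -/
abbrev ZFV : Type := MvPolynomial (Fin 2) ℤ

/-- The variable `F`. -/
abbrev F : ZFV := MvPolynomial.X 0

/-- The variable `V`. -/
abbrev V : ZFV := MvPolynomial.X 1

open Classical in
/-- The symmetric polynomial `h_π(F, V) ∈ ℤ[F, V]` of a class of non-rational Weil numbers:
`F - V` if `π` is real, and otherwise, for `P_π = x ^ (2 d) + ⋯ + a₁ x + a₀`,
`h_π = F ^ d + a_{2d-1} F ^ (d-1) + ⋯ + a_{d+1} F + a_d + a_{d+1} V + ⋯ + V ^ d`.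
It is not meant to be used for rational Weil numbers. -/
def WeilClass.symmPoly {q : ℕ} (c : WeilClass q) : ZFV :=
  if c.rep.im = 0 then F - V
  else
    MvPolynomial.C (c.minpoly.coeff (c.minpoly.natDegree / 2)) +
      ∑ r ∈ Finset.Icc 1 (c.minpoly.natDegree / 2),
        MvPolynomial.C (c.minpoly.coeff (c.minpoly.natDegree / 2 + r)) * (F ^ r + V ^ r)

/-- `h_v`, the product of the `h_π` over the classes in `v`. -/
def symmPoly {q : ℕ} (v : Finset (WeilClass q)) : ZFV := ∏ c ∈ v, c.symmPoly

/-- The ring `ℤ[F, V] / (F V - q)`. -/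
abbrev BaseRing (q : ℕ) : Type := ZFV ⧸ Ideal.span {F * V - (q : ZFV)}

theorem WeilClass.isWeilNumber_rep {q : ℕ} (c : WeilClass q) : IsWeilNumber q c.rep :=
  (Quotient.out (s := conjugacy q) c).2

theorem WeilClass.mul_div_gen {q : ℕ} (c : WeilClass q) :
    AdjoinSimple.gen ℚ c.rep * ((q : ℚ⟮c.rep⟯) / AdjoinSimple.gen ℚ c.rep) = q := by
  by_cases h : AdjoinSimple.gen ℚ c.rep = 0
  · have h1 := c.isWeilNumber_rep.2 (ℚ⟮c.rep⟯).val.toRingHom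
    rw [h, map_zero, norm_zero, eq_comm, Real.sqrt_eq_zero (Nat.cast_nonneg q)] at h1
    rw [h, zero_mul, Nat.cast_eq_zero.2 (Nat.cast_eq_zero.1 h1)]
  · exact mul_div_cancel₀ _ h

/-- The ring homomorphism `ℤ[F, V] / (F V - q) → ∏_{π ∈ w} ℚ(π)` sending `F` to the family of all
`π` and `V` to the family of all `q / π`. -/
def toProd (q : ℕ) (w : Set (WeilClass q)) :
    BaseRing q →+* ((c : w) → ℚ⟮c.1.rep⟯) :=
  Ideal.Quotient.lift (Ideal.span {F * V - (q : ZFV)})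
    (MvPolynomial.aeval (R := ℤ)
      ![fun c : w => AdjoinSimple.gen ℚ c.1.rep,
        fun c : w => (q : ℚ⟮c.1.rep⟯) / AdjoinSimple.gen ℚ c.1.rep]).toRingHom
    (fun a ha => by
      rw [← RingHom.mem_ker]
      refine (Ideal.span_le.2 ?_) ha
      rintro _ rfl
      rw [SetLike.mem_coe, RingHom.mem_ker]
      funext c
      simp [F, V, c.1.mul_div_gen])

/-- The minimal central order `R_w`, for a (finite) set `w` of classes of Weil `q`-numbers. -/
abbrev MinimalCentralOrder (q : ℕ) (w : Set (WeilClass q)) : Type :=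
  BaseRing q ⧸ RingHom.ker (toProd q w)

/-- The quotient map `ℤ[F, V] → R_w`. -/
def toOrder (q : ℕ) (w : Set (WeilClass q)) : ZFV →+* MinimalCentralOrder q w :=
  (Ideal.Quotient.mk (RingHom.ker (toProd q w))).comp
    (Ideal.Quotient.mk (Ideal.span {F * V - (q : ZFV)}))

/-- A commutative ring is Gorenstein if it is noetherian and each of its localizations at a maximal
ideal has finite injective dimension as a module over itself. -/
def IsGorenstein (R : Type) [CommRing R] : Prop :=
  IsNoetherianRing R ∧ ∀ (m : Ideal R) [m.IsMaximal], ∃ n : ℕ,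
    CategoryTheory.HasInjectiveDimensionLE
      (ModuleCat.of (Localization.AtPrime m) (Localization.AtPrime m)) n

end WeilNumber

end

/-!
Write `P` for the product of the minimal polynomials over `w = v ∪ {s}` and `D` for half the degree of
the product over `v`. A class in `v` is not real, since a real Weil number is `± s`, so its minimal
polynomial is stable under `x ↦ q / x`, and `π ^ d h_π(π, q / π) = P_π(π) = 0`.

*The presentation.* The relations hold in `R_w`. Conversely they rewrite every polynomial as a
combination of the `2 D + 1` monomials `1, F, …, F ^ D, V, …, V ^ D`, because `F h_v` and `V h_v` have
leading terms `F ^ (D + 1)` and `V ^ (D + 1)` (`aeval_mem_window`). A combination that vanishes at all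
classes in `w` gives, after multiplication by `F ^ D`, a polynomial in `F` of degree at most `2 D`
that is divisible by `P`. As `P` has degree `2 D + 1`, the combination is zero (`ker_toOrder`).

*Ordinary classes.* The functional equation makes `p` divide the coefficients of `P_π` below the middle
one, so by the slope zero part of the Newton polygon `π` is ordinary if and only if the middle
coefficient `h_π(0, 0)` is prime to `p` (`WeilClass.isOrdinary_iff`). Hence all classes in `v` are
ordinary if and only if `p` does not divide `h_v(0, 0)`.

*The ordinary case.* Let `n` be a prime ideal of `R_w`. If `F ∉ n` or `V ∉ n`, the local ring at `n` is
a localization of `ℤ[F]` or of `ℤ[V]`, both isomorphic to `ℤ[x] / (P)`. If `F, V ∈ n`, then `p ∈ n`, so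
`h_v` is a unit at `n`, the relations give `F = V = s`, and the local ring is a localization of `ℤ`. The
rings `ℤ[x] / (P)` and `ℤ` carry perfect bilinear forms over `ℤ`, so coinduction of
`0 → ℤ → ℚ → ℚ / ℤ → 0` shows that they have injective dimension at most one
(`hasInjectiveDimensionLE_one_of_frobenius`), and this passes to localizations.

*The non-ordinary case.* If `p` divides `h_v(0, 0)`, then modulo `p` the element `h_v` is the sum of a
part in `F` and a part in `V`, and both are killed by `F` and by `V`. They are independent socle elements
modulo `p` of the local ring at `(p, F, V)` (`PresentsOrder.mul_single_notMem`). But if this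
one-dimensional local ring `S` had finite injective dimension, `Ext¹(J, S)` would vanish for every ideal
`J` containing `p` (`ext_one_subsingleton_of_hasInjectiveDimensionLE`), and then the socle of `S / (p)`
would be at most one-dimensional (`mem_span_pair_of_ext_one_subsingleton`).
-/

noncomputable section
namespace WeilNumber
open CategoryTheory

/-! ### Orders that are Frobenius over the integers -/

open ModuleCat in
/-- Coinduction from `ℤ` preserves injectives, so `0 → ℤ → ℚ → ℚ/ℤ → 0` coinduces to an injective
resolution of `Hom_ℤ(D, ℤ) ≅ D`. -/
theorem hasInjectiveDimensionLE_one_of_frobenius {D : Type} [CommRing D] [Module.Free ℤ D]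
    (lam : D →+ ℤ) (inj : ∀ d, (∀ x, lam (x * d) = 0) → d = 0)
    (surj : ∀ φ : D →+ ℤ, ∃ d, ∀ x, φ x = lam (x * d)) :
    HasInjectiveDimensionLE (ModuleCat.of D D) 1 := by
  let f : ℤ →+* D := algebraMap ℤ D
  have hinj (E : Type) [AddCommGroup E] [DivisibleBy E ℤ] :
      Injective ((coextendScalars f).obj (of ℤ E)) :=
    (restrictCoextendScalarsAdj f).map_injective _
      (Module.injective_object_of_injective_module (inj := (Module.Baer.of_divisible E).injective))
  let π : ℚ →ₗ[ℤ] AddCircle (1 : ℚ) := (QuotientAddGroup.mk' _).toIntLinearMap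
  have hlam (r : ℤ) (x : D) : lam (f r * x) = r * lam x := by
    have h := map_zsmul lam r x
    rwa [zsmul_eq_mul, smul_eq_mul] at h
  let α : of D D ⟶ (coextendScalars f).obj (of ℤ ℚ) :=
    RestrictionCoextensionAdj.HomEquiv.fromRestriction f
      (ofHom (X := (restrictScalars f).obj (of D D))
      { toFun := fun x : D => ((lam x : ℤ) : ℚ)
        map_add' := fun x y => by
          have : lam ((x : D) + (y : D)) = lam x + lam y := map_add lam x y
          exact_mod_cast this
        map_smul' := fun r (x : D) => by
          change ((lam (f r * x) : ℤ) : ℚ) = r * (lam x : ℚ)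
          rw [hlam]; push_cast; rfl })
  let β := (coextendScalars f).map (ofHom π)
  have hπ (a : ℚ) : π a = 0 ↔ ∃ n : ℤ, (n : ℚ) = a := by
    have : π a = (a : AddCircle (1 : ℚ)) := rfl
    rw [this, AddCircle.coe_eq_zero_iff]
    simp
  have hαβ (d : D) : β.hom (α.hom d) = 0 := by
    apply CoextendScalars.ext
    apply LinearMap.ext
    intro s
    exact (hπ _).2 ⟨_, rfl⟩
  let T : ShortComplex (ModuleCat D) := ShortComplex.mk α β
    (ModuleCat.hom_ext (LinearMap.ext hαβ))
  have hT : T.ShortExact := by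
    refine ModuleCat.shortComplex_shortExact T ?_ ?_ ?_
    · intro φ
      refine ⟨fun h => ?_, ?_⟩
      · have h2 (s : D) : ∃ n : ℤ, (n : ℚ) = CoextendScalars.equiv f _ φ s :=
          (hπ _).1 (congrArg (fun ψ => CoextendScalars.equiv f _ ψ s) h)
        choose g hg using h2
        obtain ⟨d, hd⟩ := surj (AddMonoidHom.mk' g fun a b => by
          have h3 : ((g (a + b) : ℤ) : ℚ) = g a + g b :=
            (hg (a + b)).trans ((map_add (CoextendScalars.equiv f _ φ) a b).trans
              (congrArg₂ (· + ·) (hg a) (hg b)).symm)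
          exact_mod_cast h3)
        refine ⟨d, CoextendScalars.ext (LinearMap.ext fun s => ?_)⟩
        exact (congrArg (Int.cast : ℤ → ℚ) (hd s)).symm.trans (hg s)
      · rintro ⟨d, rfl⟩
        exact hαβ d
    · refine (injective_iff_map_eq_zero _).2 fun d hd => inj d fun x => ?_
      have h2 : ((lam (x * d) : ℤ) : ℚ) = 0 :=
        congrArg (fun ψ => CoextendScalars.equiv f _ ψ x) hd
      exact_mod_cast h2
    · intro φ
      obtain ⟨ψ, hψ⟩ := Module.projective_lifting_property π
        (AddMonoidHom.mk' (fun x : D => (CoextendScalars.equiv f _ φ x : AddCircle (1 : ℚ)))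
          fun a b => map_add (CoextendScalars.equiv f _ φ) a b).toIntLinearMap
        (QuotientAddGroup.mk'_surjective _)
      let ψ' : (restrictScalars f).obj (of D D) →ₗ[ℤ] ℚ :=
        { toFun := fun x : D => ψ x
          map_add' := fun x y => map_add ψ (x : D) (y : D)
          map_smul' := fun r (x : D) => by
            change ψ (f r * x) = r • ψ x
            rw [← map_zsmul ψ r x, zsmul_eq_mul]
            rfl }
      refine ⟨(CoextendScalars.equiv f (of ℤ ℚ)).symm ψ', CoextendScalars.ext
        (LinearMap.ext fun s => ?_)⟩
      exact LinearMap.congr_fun hψ s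
  have h0 : Injective T.X₂ := hinj ℚ
  have h1 : Injective T.X₃ := hinj (AddCircle (1 : ℚ))
  exact hT.hasInjectiveDimensionLT_X₁ 1 inferInstance inferInstance

attribute [local instance] RingHomInvPair.of_ringEquiv in
/-- Injective dimension of a noetherian ring over itself does not grow under localization. -/
theorem hasInjectiveDimensionLE_of_isLocalization {D S : Type} [CommRing D] [CommRing S]
    [IsNoetherianRing D] (M : Submonoid D) [Algebra D S] [IsLocalization M S] (n : ℕ)
    (h : HasInjectiveDimensionLE (ModuleCat.of D D) n) :
    HasInjectiveDimensionLE (ModuleCat.of S S) n := by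
  have h1 := (ModuleCat.of D D).localizedModule_hasInjectiveDimensionLE n M
  have := ModuleCat.localizedModule_isLocalizedModule (ModuleCat.of D D) M
  have h2 : HasInjectiveDimensionLE (ModuleCat.of (Localization M) (Localization M)) n :=
    (ModuleCat.hasInjectiveDimensionLE_iff_of_linearEquiv
      (LinearEquiv.extendScalarsOfIsLocalization M (Localization M)
        (IsLocalizedModule.linearEquiv M ((ModuleCat.of D D).localizedModuleMkLinearMap M)
          (Algebra.linearMap D (Localization M)))) n).1 h1
  let e : Localization M ≃ₐ[D] S := IsLocalization.algEquiv M (Localization M) S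
  exact (ModuleCat.hasInjectiveDimensionLE_iff_of_semiLinearEquiv e.toRingEquiv
    (M := ModuleCat.of (Localization M) (Localization M)) (N := ModuleCat.of S S)
    { e.toRingEquiv with
      map_smul' := fun r x => map_mul e r x } n).1 h2

/-- A criterion for the localization of `R` at a prime `n` to be at the same time the localization
of `D` at the contraction of `n`: up to factors outside `n`, every element of `R` is a fraction with
numerator and denominator in the image of `D`. -/
theorem isLocalization_comap_primeCompl {D R : Type} [CommRing D] [CommRing R] (j : D →+* R)
    (n : Ideal R) [n.IsPrime]
    (hsurj : ∀ r : R, ∃ t ∉ n, ∃ a b, j b ∉ n ∧ t * (j b * r - j a) = 0)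
    (hinj : ∀ c : D, ∀ t ∉ n, t * j c = 0 → ∃ b, j b ∉ n ∧ b * c = 0) :
    letI := ((algebraMap R (Localization.AtPrime n)).comp j).toAlgebra
    IsLocalization (n.comap j).primeCompl (Localization.AtPrime n) := by
  let _ := ((algebraMap R (Localization.AtPrime n)).comp j).toAlgebra
  have hal (d : D) : algebraMap D (Localization.AtPrime n) d = algebraMap R _ (j d) := rfl
  have hzero (r : R) : algebraMap R (Localization.AtPrime n) r = 0 ↔ ∃ t ∉ n, t * r = 0 := by
    rw [IsLocalization.map_eq_zero_iff n.primeCompl]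
    exact ⟨fun ⟨t, h⟩ => ⟨t.1, t.2, h⟩, fun ⟨t, h, h2⟩ => ⟨⟨t, h⟩, h2⟩⟩
  have hfrac (r : R) : ∃ a b, j b ∉ n ∧
      algebraMap R (Localization.AtPrime n) (j b) * algebraMap R _ r = algebraMap R _ (j a) := by
    obtain ⟨t, ht, a, b, hb, h⟩ := hsurj r
    refine ⟨a, b, hb, ?_⟩
    rw [← map_mul, ← sub_eq_zero, ← map_sub]
    exact (hzero _).2 ⟨t, ht, h⟩
  refine ⟨fun y => ?_, fun z => ?_, fun {x y} h => ?_⟩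
  · exact IsLocalization.map_units (Localization.AtPrime n) (⟨j y.1, y.2⟩ : n.primeCompl)
  · obtain ⟨⟨r, t⟩, h⟩ := IsLocalization.surj n.primeCompl z
    obtain ⟨a, b, hb, hr⟩ := hfrac r
    obtain ⟨a', b', hb', ht⟩ := hfrac t
    have ha' : j a' ∉ n := by
      intro hmem
      have h3 : IsUnit (algebraMap R (Localization.AtPrime n) (j a')) := by
        rw [← ht]
        exact (IsLocalization.map_units _ (⟨j b', hb'⟩ : n.primeCompl)).mul
          (IsLocalization.map_units _ t)
      exact (IsLocalization.AtPrime.isUnit_to_map_iff (Localization.AtPrime n) n (j a')).1 h3 hmem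
    refine ⟨(b' * a, ⟨b * a', ?_⟩), ?_⟩
    · change j (b * a') ∉ n
      rw [map_mul]
      exact fun hm => (‹n.IsPrime›.mem_or_mem hm).elim hb ha'
    · simp only [hal, map_mul] at h ⊢
      rw [← ht, ← hr, ← h]
      ring
  · rw [hal, hal, ← sub_eq_zero, ← map_sub, ← map_sub] at h
    obtain ⟨t, ht, h⟩ := (hzero _).1 h
    obtain ⟨b, hb, h⟩ := hinj _ t ht h
    exact ⟨⟨b, hb⟩, by rw [← sub_eq_zero, ← mul_sub]; exact h⟩

open Polynomial in
/-- For monic `f ∈ ℤ[x]` of degree `n > 0`, the coefficient of `x ^ (n - 1)` is a functional on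
`ℤ[x] / (f)` whose associated bilinear form is perfect: its matrix in the basis of powers of `x` is
triangular with respect to the antidiagonal, with ones on the antidiagonal. -/
theorem hasInjectiveDimensionLE_one_adjoinRoot {f : ℤ[X]} (hf : f.Monic) (hn : 0 < f.natDegree) :
    HasInjectiveDimensionLE (ModuleCat.of (AdjoinRoot f) (AdjoinRoot f)) 1 := by
  set n := f.natDegree with hnf
  have : Module.Free ℤ (AdjoinRoot f) := Module.Free.of_basis (AdjoinRoot.powerBasis' hf).basis
  have hdeg : f.degree = n := degree_eq_natDegree hf.ne_zero
  let lam : AdjoinRoot f →ₗ[ℤ] ℤ := (lcoeff ℤ (n - 1)).comp (AdjoinRoot.modByMonicHom hf)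
  have hlam (g : ℤ[X]) (hg : g.degree < n) : lam (AdjoinRoot.mk f g) = g.coeff (n - 1) := by
    simp only [lam, LinearMap.comp_apply, AdjoinRoot.modByMonicHom_mk, lcoeff_apply]
    rw [(modByMonic_eq_self_iff hf).2 (hdeg ▸ hg)]
  have hpow (i : ℕ) (hi : i < n) :
      lam (AdjoinRoot.root f ^ i) = if i = n - 1 then 1 else 0 := by
    rw [← AdjoinRoot.mk_X, ← map_pow, hlam, coeff_X_pow]
    · simp only [eq_comm]
    · rw [degree_X_pow]; exact_mod_cast hi
  refine hasInjectiveDimensionLE_one_of_frobenius lam.toAddMonoidHom (fun d hd => ?_) fun φ => ?_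
  · obtain ⟨g, rfl⟩ := AdjoinRoot.mk_surjective d
    obtain ⟨g, hg, hgd⟩ : ∃ g' : ℤ[X], AdjoinRoot.mk f g' = AdjoinRoot.mk f g ∧ g'.degree < n :=
      ⟨g %ₘ f, by simpa using AdjoinRoot.mk_leftInverse hf (AdjoinRoot.mk f g),
        hdeg ▸ degree_modByMonic_lt g hf⟩
    rw [← hg] at hd ⊢
    by_contra hne
    have hg0 : g ≠ 0 := fun h => hne (by rw [h, map_zero])
    have hk : g.natDegree < n := (natDegree_lt_iff_degree_lt hg0).2 hgd
    have h1 : lam (AdjoinRoot.mk f (X ^ (n - 1 - g.natDegree)) * AdjoinRoot.mk f g) = 0 := hd _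
    rw [← map_mul, hlam, coeff_X_pow_mul', if_pos (Nat.sub_le _ _), Nat.sub_sub_self (by lia)] at h1
    · exact hg0 (leadingCoeff_eq_zero.1 h1)
    · rw [degree_mul, degree_X_pow, degree_eq_natDegree hg0]
      exact_mod_cast (by lia : n - 1 - g.natDegree + g.natDegree < n)
  · have key : ∀ m ≤ n, ∃ d, ∀ j < m, φ (AdjoinRoot.root f ^ j) = lam (AdjoinRoot.root f ^ j * d) := by
      intro m
      induction m with
      | zero => exact fun _ => ⟨0, fun j hj => absurd hj (Nat.not_lt_zero j)⟩
      | succ m ih =>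
        intro hm
        obtain ⟨d, hd⟩ := ih (by lia)
        -- a multiple of `x ^ (n - 1 - m)` corrects the value at `x ^ m` and no earlier one
        refine ⟨d + (φ (AdjoinRoot.root f ^ m) - lam (AdjoinRoot.root f ^ m * d)) •
          AdjoinRoot.root f ^ (n - 1 - m), fun j hj => ?_⟩
        rw [mul_add, mul_smul_comm, ← pow_add, map_add, map_smul, hpow _ (by lia)]
        rcases Nat.lt_succ_iff_lt_or_eq.1 hj with h | rfl
        · rw [if_neg (by lia), hd j h, smul_zero, add_zero]
        · rw [if_pos (by lia), smul_eq_mul, mul_one]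
          ring
    obtain ⟨d, hd⟩ := key n le_rfl
    refine ⟨d, LinearMap.congr_fun (f := φ.toIntLinearMap)
      (g := lam.comp (LinearMap.mulRight ℤ d)) ?_⟩
    refine (AdjoinRoot.powerBasis' hf).basis.ext fun i => ?_
    have hi : (i : ℕ) < n := i.2.trans_eq (AdjoinRoot.powerBasis'_dim hf)
    simpa using hd i hi

theorem hasInjectiveDimensionLE_one_int :
    HasInjectiveDimensionLE (ModuleCat.of ℤ ℤ) 1 :=
  hasInjectiveDimensionLE_one_of_frobenius (AddMonoidHom.id ℤ)
    (fun d hd => by simpa using hd 1) fun φ => ⟨φ 1, fun x => by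
      simpa using map_zsmul φ x 1⟩

/-! ### Finite injective dimension and the socle modulo a regular element -/

section Ext

open Abelian

variable {S : Type} [CommRing S]

/-- The exact sequence `0 → I → J → J / I → 0` relates the groups `Ext` of three modules. -/
theorem ext_subsingleton_of_exact {M N P Y : Type} [AddCommGroup M] [Module S M] [AddCommGroup N]
    [Module S N] [AddCommGroup P] [Module S P] [AddCommGroup Y] [Module S Y]
    (f : M →ₗ[S] N) (g : N →ₗ[S] P) (hf : Function.Injective f) (hg : Function.Surjective g)
    (hfg : Function.Exact f g) (i : ℕ) :
    (Subsingleton (Ext (ModuleCat.of S N) (ModuleCat.of S Y) i) →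
      Subsingleton (Ext (ModuleCat.of S P) (ModuleCat.of S Y) (i + 1)) →
      Subsingleton (Ext (ModuleCat.of S M) (ModuleCat.of S Y) i)) ∧
    (Subsingleton (Ext (ModuleCat.of S M) (ModuleCat.of S Y) i) →
      Subsingleton (Ext (ModuleCat.of S N) (ModuleCat.of S Y) (i + 1)) →
      Subsingleton (Ext (ModuleCat.of S P) (ModuleCat.of S Y) (i + 1))) := by
  let T : ShortComplex (ModuleCat S) := ShortComplex.mk (ModuleCat.ofHom f) (ModuleCat.ofHom g)
    (ModuleCat.hom_ext (LinearMap.ext fun x => hfg.apply_apply_eq_zero x))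
  have hT : T.ShortExact := ModuleCat.shortComplex_shortExact T hfg hf hg
  refine ⟨fun h1 h2 => subsingleton_of_forall_eq 0 fun x => ?_,
    fun h1 h2 => subsingleton_of_forall_eq 0 fun x => ?_⟩
  · obtain ⟨y, rfl⟩ := Ext.contravariant_sequence_exact₁ hT (ModuleCat.of S Y) x (add_comm 1 i)
      (h2.elim _ _)
    rw [h1.elim y 0, Ext.comp_zero]
  · obtain ⟨y, rfl⟩ := Ext.contravariant_sequence_exact₃ hT (ModuleCat.of S Y) x (h2.elim _ _)
      (add_comm 1 i)
    rw [h1.elim y 0, Ext.comp_zero]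

open IsLocalRing

/-- If every prime containing `x` is maximal, each proper ideal containing `x` has a socle element
modulo it. -/
theorem exists_notMem_mul_mem [IsLocalRing S] [IsNoetherianRing S] {x : S}
    (hx : ∀ Q : Ideal S, Q.IsPrime → x ∈ Q → Q = maximalIdeal S) {I : Ideal S} (hxI : x ∈ I)
    (hI : I ≠ ⊤) : ∃ a ∉ I, ∀ r ∈ maximalIdeal S, r * a ∈ I := by
  have : Nontrivial (S ⧸ I) := Ideal.Quotient.nontrivial_iff.2 hI
  obtain ⟨P, hP⟩ := associatedPrimes.nonempty S (S ⧸ I)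
  obtain ⟨hprime, z, hz⟩ := isAssociatedPrime_iff.1 hP
  obtain ⟨a, rfl⟩ := Ideal.Quotient.mk_surjective z
  have hmem (r : S) : r ∈ P ↔ r * a ∈ I := by
    rw [hz, Submodule.mem_colon_singleton, Submodule.mem_bot, Algebra.smul_def,
      Ideal.Quotient.algebraMap_eq, ← map_mul, Ideal.Quotient.eq_zero_iff_mem]
  have hPm : P = maximalIdeal S := hx P hprime ((hmem x).2 (I.mul_mem_right a hxI))
  refine ⟨a, fun ha => hprime.ne_top ((Ideal.eq_top_iff_one P).2 ((hmem 1).2 ?_)),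
    fun r hr => (hmem r).1 (hPm ▸ hr)⟩
  rwa [one_mul]

/-- If `a ∉ I` and `𝔪 a ⊆ I` then `(I + (a)) / I` is the residue field. -/
theorem exists_exact_residue [IsLocalRing S] {I : Ideal S} {a : S} (ha : a ∉ I)
    (hma : ∀ r ∈ maximalIdeal S, r * a ∈ I) :
    ∃ g : (I ⊔ Ideal.span {a} : Ideal S) →ₗ[S] S ⧸ maximalIdeal S,
      Function.Surjective g ∧ ∀ y, g y = 0 ↔ (y : S) ∈ I := by
  let I' : Ideal S := I ⊔ Ideal.span {a}
  let a' : I' := ⟨a, Ideal.mem_sup_right (Ideal.mem_span_singleton_self a)⟩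
  let N : Submodule S I' := Submodule.comap I'.subtype I
  let φ : S →ₗ[S] I' ⧸ N := N.mkQ.comp (LinearMap.toSpanSingleton S I' a')
  have hφ (s : S) : φ s = 0 ↔ s * a ∈ I := Submodule.Quotient.mk_eq_zero N
  have hker : LinearMap.ker φ = maximalIdeal S := by
    refine le_antisymm (IsLocalRing.le_maximalIdeal fun h => ha ?_) fun r hr => (hφ r).2 (hma r hr)
    have h1 : (1 : S) ∈ LinearMap.ker φ := h ▸ Submodule.mem_top
    simpa using (hφ 1).1 h1
  have hsurj : Function.Surjective φ := by
    intro z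
    obtain ⟨⟨y, hy⟩, rfl⟩ := N.mkQ_surjective z
    obtain ⟨b, hb, c, hc, rfl⟩ := Submodule.mem_sup.1 hy
    obtain ⟨s, rfl⟩ := Ideal.mem_span_singleton'.1 hc
    refine ⟨s, (Submodule.Quotient.eq N).2 ?_⟩
    change s * a - (b + s * a) ∈ I
    rw [sub_add_cancel_right]
    exact neg_mem hb
  let e : (S ⧸ maximalIdeal S) ≃ₗ[S] I' ⧸ N :=
    (Submodule.quotEquivOfEq _ _ hker.symm).trans (φ.quotKerEquivOfSurjective hsurj)
  refine ⟨e.symm.toLinearMap.comp N.mkQ, e.symm.surjective.comp N.mkQ_surjective, fun y => ?_⟩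
  rw [LinearMap.comp_apply, LinearEquiv.coe_coe, LinearEquiv.map_eq_zero_iff]
  exact Submodule.Quotient.mk_eq_zero N

/-- A one-dimensional local ring of finite injective dimension has injective dimension one, in the
form `Ext¹(J, S) = Ext²(S / J, S) = 0` for the ideals `J` containing a given nonzerodivisor `x`.
By descending induction on `i ≥ 1`, `Extⁱ(J, S) = 0` for all these `J`: as the residue field `k` is
a submodule of `S / (x)`, and `(x)` is free, the case `i + 1` gives `Extⁱ⁺¹(k, S) = 0`, and every `J`
is obtained from `S` by finitely many steps with factor `k`. -/
theorem ext_one_subsingleton_of_hasInjectiveDimensionLE [IsLocalRing S] [IsNoetherianRing S] {x : S}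
    (hx0 : ∀ s, s * x = 0 → s = 0) (hxm : x ∈ maximalIdeal S)
    (hx : ∀ Q : Ideal S, Q.IsPrime → x ∈ Q → Q = maximalIdeal S)
    {n : ℕ} (hn : HasInjectiveDimensionLE (ModuleCat.of S S) n) (J : Ideal S) (hJ : x ∈ J) :
    Subsingleton (Ext (ModuleCat.of S J) (ModuleCat.of S S) 1) := by
  have hfree (i : ℕ) : Subsingleton (Ext (ModuleCat.of S S) (ModuleCat.of S S) (i + 1)) :=
    subsingleton_of_forall_eq 0 fun y => y.eq_zero_of_projective
  have step (i : ℕ)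
      (h : ∀ J : Ideal S, x ∈ J → Subsingleton (Ext (ModuleCat.of S J) (ModuleCat.of S S) (i + 2)))
      (J : Ideal S) (hJ : x ∈ J) :
      Subsingleton (Ext (ModuleCat.of S J) (ModuleCat.of S S) (i + 1)) := by
    have hk : Subsingleton
        (Ext (ModuleCat.of S (S ⧸ maximalIdeal S)) (ModuleCat.of S S) (i + 2)) := by
      obtain ⟨a, ha, hma⟩ := exists_notMem_mul_mem hx (Ideal.mem_span_singleton_self x)
        (fun htop => (Ideal.IsPrime.ne_top inferInstance : maximalIdeal S ≠ ⊤)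
          (eq_top_iff.2 (htop ▸ (Ideal.span_singleton_le_iff_mem _).2 hxm)))
      obtain ⟨g, hg, hg0⟩ := exists_exact_residue ha hma
      let x' : (Ideal.span {x} ⊔ Ideal.span {a} : Ideal S) :=
        ⟨x, Ideal.mem_sup_left (Ideal.mem_span_singleton_self x)⟩
      refine (ext_subsingleton_of_exact (LinearMap.toSpanSingleton S _ x') g ?_ hg ?_ (i + 1)).2
        (hfree i) (h _ x'.2)
      · exact (injective_iff_map_eq_zero _).2 fun s hs => hx0 s (congrArg Subtype.val hs)
      · intro y
        rw [hg0, Ideal.mem_span_singleton']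
        exact ⟨fun ⟨s, hs⟩ => ⟨s, Subtype.ext hs⟩, fun ⟨s, hs⟩ => ⟨s, congrArg Subtype.val hs⟩⟩
    induction J using IsNoetherian.induction (R := S) (M := S) with
    | _ J ih =>
      by_cases htop : J = ⊤
      · subst htop
        exact subsingleton_of_forall_eq 0 fun y =>
          haveI : Projective (ModuleCat.of S (⊤ : Ideal S)) :=
            ModuleCat.projective_of_free
              ((Module.Basis.singleton Unit S).map (Submodule.topEquiv (R := S) (M := S)).symm)
          y.eq_zero_of_projective
      · obtain ⟨a, ha, hma⟩ := exists_notMem_mul_mem hx hJ htop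
        obtain ⟨g, hg, hg0⟩ := exists_exact_residue ha hma
        refine (ext_subsingleton_of_exact (Submodule.inclusion le_sup_left) g
          (Submodule.inclusion_injective _) hg ?_ (i + 1)).1
          (ih _ ?_ (Ideal.mem_sup_left hJ)) hk
        · intro y
          rw [hg0]
          exact ⟨fun h => ⟨⟨y, h⟩, rfl⟩, fun ⟨z, hz⟩ => hz ▸ z.2⟩
        · exact left_lt_sup.2 fun hle => ha (hle (Ideal.mem_span_singleton_self a))
  have all (k : ℕ) : ∀ i, n ≤ i + k → ∀ J : Ideal S, x ∈ J →
      Subsingleton (Ext (ModuleCat.of S J) (ModuleCat.of S S) (i + 1)) := by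
    induction k with
    | zero => exact fun i hi J _ => hn.subsingleton _ _ _ (by lia) _
    | succ k ih => exact fun i hi => step i fun J hJ => ih (i + 1) (by lia) J hJ
  exact all n 0 (by lia) J hJ

/-- If `Ext¹((a, x), S) = 0`, every linear map from the relations between `a` and `x` to `S` extends
to `S²`. Applied to `(r, s) ↦ r b / x`, this shows that a socle element `b` modulo `x` lies in the ideal
generated by any nonzero `a` modulo `x`: the socle of `S / (x)` is at most one-dimensional. -/
theorem mem_span_pair_of_ext_one_subsingleton [IsLocalRing S] {x a b : S}
    (hx0 : ∀ s, s * x = 0 → s = 0) (ha : a ∉ Ideal.span {x})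
    (hmb : ∀ r ∈ maximalIdeal S, r * b ∈ Ideal.span {x})
    (h : Subsingleton (Ext (ModuleCat.of S (Ideal.span {a, x})) (ModuleCat.of S S) 1)) :
    b ∈ Ideal.span {a, x} := by
  let J := Ideal.span {a, x}
  let a' : J := ⟨a, Ideal.subset_span (by simp)⟩
  let x' : J := ⟨x, Ideal.subset_span (by simp)⟩
  let π : S × S →ₗ[S] J := (LinearMap.toSpanSingleton S J a').coprod
    (LinearMap.toSpanSingleton S J x')
  have hπ (r s : S) : (π (r, s) : S) = r * a + s * x := rfl
  have hπs : Function.Surjective π := fun ⟨y, hy⟩ => by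
    obtain ⟨r, s, h⟩ := Ideal.mem_span_pair.1 hy
    exact ⟨(r, s), Subtype.ext h⟩
  have hK (z : LinearMap.ker π) : z.1.1 ∈ maximalIdeal S := by
    intro hu
    have h0 : z.1.1 * a + z.1.2 * x = 0 := congrArg Subtype.val (LinearMap.mem_ker.1 z.2)
    obtain ⟨u, hu⟩ := hu
    refine ha (Ideal.mem_span_singleton'.2 ⟨-(↑u⁻¹ * z.1.2), ?_⟩)
    rw [← hu] at h0
    linear_combination -(↑u⁻¹ : S) * h0 + a * u.inv_mul
  have hdiv (z : LinearMap.ker π) : ∃ c, c * x = z.1.1 * b :=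
    Ideal.mem_span_singleton'.1 (hmb _ (hK z))
  choose ψ hψ using hdiv
  have hcancel {s t : S} (h : s * x = t * x) : s = t :=
    sub_eq_zero.1 (hx0 _ (by rw [sub_mul, h, sub_self]))
  let Ψ : LinearMap.ker π →ₗ[S] S :=
    { toFun := ψ
      map_add' := fun z w => hcancel (by
        rw [add_mul, hψ, hψ, hψ, ← add_mul]; rfl)
      map_smul' := fun r z => hcancel (by
        rw [RingHom.id_apply, smul_eq_mul, mul_assoc, hψ, hψ, ← mul_assoc]; rfl) }
  have hT : (LinearMap.shortComplexKer π).ShortExact := LinearMap.shortExact_shortComplexKer hπs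
  obtain ⟨Φ, hΦ⟩ := Ext.contravariant_sequence_exact₁ hT (ModuleCat.of S S)
    (Ext.mk₀ (ModuleCat.ofHom Ψ)) (add_zero 1) (h.elim _ _)
  obtain ⟨Φ, rfl⟩ := Ext.homEquiv₀.symm.surjective Φ
  have hΦ' (z : LinearMap.ker π) : Φ.hom z.1 = ψ z := by
    have h2 : (LinearMap.shortComplexKer π).f ≫ Φ = ModuleCat.ofHom Ψ :=
      Ext.homEquiv₀.symm.injective (by simpa using hΦ)
    exact LinearMap.congr_fun (congrArg ModuleCat.Hom.hom h2) z
  -- the relation `x * a + (-a) * x = 0`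
  let z : LinearMap.ker π := ⟨(x, -a), LinearMap.mem_ker.2 (Subtype.ext (by
    rw [hπ]; simp only [ZeroMemClass.coe_zero]; ring))⟩
  have h3 : ψ z = b := hcancel (by rw [hψ]; exact mul_comm _ _)
  have h4 : Φ.hom (x, -a) = x * Φ.hom (1, 0) + -a * Φ.hom (0, 1) := by
    rw [← smul_eq_mul, ← smul_eq_mul, ← map_smul, ← map_smul, ← map_add]
    simp
  refine Ideal.mem_span_pair.2 ⟨-Φ.hom (0, 1), Φ.hom (1, 0), ?_⟩
  rw [← h3, ← hΦ' z]
  refine Eq.trans ?_ h4.symm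
  ring

end Ext

/-! ### Minimal polynomials of Weil numbers -/

open Polynomial IntermediateField

section Minpoly

variable {q : ℕ} (c : WeilClass q)

theorem WeilClass.norm_rep : ‖c.rep‖ = Real.sqrt q :=
  c.isWeilNumber_rep.2 (ℚ⟮c.rep⟯).val.toRingHom

theorem WeilClass.rep_ne_zero (hq : 0 < q) : c.rep ≠ 0 := by
  rw [← norm_ne_zero_iff, c.norm_rep]
  exact (Real.sqrt_pos.2 (Nat.cast_pos.2 hq)).ne'

theorem WeilClass.conj_rep (hq : 0 < q) : (starRingEnd ℂ) c.rep = q / c.rep := by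
  rw [eq_div_iff (c.rep_ne_zero hq), mul_comm, Complex.mul_conj, Complex.normSq_eq_norm_sq,
    c.norm_rep, Real.sq_sqrt (Nat.cast_nonneg q), Complex.ofReal_natCast]

theorem WeilClass.isIntegral_rep : IsIntegral ℤ c.rep := c.isWeilNumber_rep.1

theorem WeilClass.monic_minpoly : c.minpoly.Monic := minpoly.monic c.isIntegral_rep

theorem WeilClass.irreducible_minpoly : Irreducible c.minpoly := minpoly.irreducible c.isIntegral_rep

theorem WeilClass.natDegree_minpoly_pos : 0 < c.minpoly.natDegree :=
  minpoly.natDegree_pos c.isIntegral_rep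

theorem WeilClass.aeval_rep_minpoly : aeval c.rep c.minpoly = 0 := minpoly.aeval ℤ c.rep

theorem WeilClass.aeval_rep_eq_zero_iff (g : ℤ[X]) : aeval c.rep g = 0 ↔ c.minpoly ∣ g :=
  minpoly.isIntegrallyClosed_dvd_iff c.isIntegral_rep g

theorem WeilClass.aeval_div_rep (hq : 0 < q) (g : ℤ[X]) :
    aeval (q / c.rep) g = (starRingEnd ℂ) (aeval c.rep g) := by
  rw [← c.conj_rep hq]
  exact aeval_algHom_apply (starRingEnd ℂ).toIntAlgHom c.rep g

theorem WeilClass.aeval_div_rep_minpoly (hq : 0 < q) : aeval (q / c.rep) c.minpoly = 0 := by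
  rw [c.aeval_div_rep hq, c.aeval_rep_minpoly, map_zero]

theorem WeilClass.minpoly_injective {c c' : WeilClass q} (h : c.minpoly = c'.minpoly) : c = c' := by
  rw [← Quotient.out_eq (s := conjugacy q) c, ← Quotient.out_eq (s := conjugacy q) c']
  refine Quotient.sound (s := conjugacy q) ?_
  have h2 : _root_.minpoly ℚ c.rep = _root_.minpoly ℚ c'.rep := by
    rw [minpoly.isIntegrallyClosed_eq_field_fractions' ℚ c.isIntegral_rep,
      minpoly.isIntegrallyClosed_eq_field_fractions' ℚ c'.isIntegral_rep]
    exact congrArg _ h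
  have halg : IsAlgebraic ℚ c.rep := (c.isIntegral_rep.tower_top (A := ℚ)).isAlgebraic
  exact ⟨(minpoly.algEquiv halg h2).toRingEquiv, minpoly.algEquiv_apply halg h2⟩

theorem WeilClass.rep_ofInt {s : ℤ} (hs : s ^ 2 = (q : ℤ)) : (WeilClass.ofInt s hs).rep = s := by
  obtain ⟨σ, h⟩ : IsConjugate (WeilClass.ofInt s hs).rep (s : ℂ) :=
    Quotient.mk_out (s := conjugacy q) ⟨(s : ℂ), isWeilNumber_intCast hs⟩
  have h1 : AdjoinSimple.gen ℚ (s : ℂ) = (s : ℚ⟮(s : ℂ)⟯) := Subtype.ext (by simp)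
  rw [h1, ← map_intCast σ s] at h
  simpa using congrArg Subtype.val (σ.injective h)

theorem WeilClass.eval_minpoly_ne_zero {c : WeilClass q} (hc : ¬ c.IsRational) (t : ℤ) :
    c.minpoly.eval t ≠ 0 := by
  intro h
  have h2 := (irreducible_X_sub_C t).dvd_symm c.irreducible_minpoly (dvd_iff_isRoot.2 h)
  rw [← c.aeval_rep_eq_zero_iff] at h2
  refine hc ⟨t, ?_⟩
  simpa [sub_eq_zero] using h2

/-- A real Weil `q`-number has absolute value `|s|`, so it is `± s`. -/
theorem WeilClass.im_rep_ne_zero {c : WeilClass q} (hc : ¬ c.IsRational) {s : ℤ}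
    (hs : s ^ 2 = (q : ℤ)) : c.rep.im ≠ 0 := by
  intro h
  have h1 : c.rep = (c.rep.re : ℂ) := Complex.ext rfl (by simp [h])
  have h2 : |c.rep.re| = |(s : ℝ)| := by
    rw [← Real.norm_eq_abs, ← Complex.norm_real, ← h1, c.norm_rep, ← Real.sqrt_sq_eq_abs]
    congr 1
    exact_mod_cast hs.symm
  rcases abs_eq_abs.1 h2 with h3 | h3
  · exact hc ⟨s, by rw [h1, h3]; simp⟩
  · exact hc ⟨-s, by rw [h1, h3]; simp⟩

end Minpoly

/-- The polynomial `x ^ N P(q / x)`, where `N` is the degree of `P`. -/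
def reciprocal (q : ℕ) (P : ℤ[X]) : ℤ[X] :=
  ∑ i ∈ Finset.range (P.natDegree + 1),
    C (P.coeff (P.natDegree - i) * q ^ (P.natDegree - i)) * X ^ i

theorem coeff_reciprocal (q : ℕ) (P : ℤ[X]) {i : ℕ} (hi : i ≤ P.natDegree) :
    (reciprocal q P).coeff i = P.coeff (P.natDegree - i) * q ^ (P.natDegree - i) := by
  rw [reciprocal, finsetSum_coeff, Finset.sum_eq_single i]
  · rw [coeff_C_mul_X_pow, if_pos rfl]
  · intro j _ hj
    rw [coeff_C_mul_X_pow, if_neg hj.symm]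
  · intro h
    exact absurd (Finset.mem_range.2 (Nat.lt_succ_of_le hi)) h

theorem natDegree_reciprocal_le (q : ℕ) (P : ℤ[X]) :
    (reciprocal q P).natDegree ≤ P.natDegree :=
  natDegree_sum_le_of_forall_le _ _ fun _ hi =>
    (natDegree_C_mul_X_pow_le _ _).trans (Nat.lt_succ_iff.1 (Finset.mem_range.1 hi))

theorem aeval_reciprocal (q : ℕ) (P : ℤ[X]) {K : Type*} [Field K] {x : K} (hx : x ≠ 0) :
    aeval x (reciprocal q P) = x ^ P.natDegree * aeval (q / x) P := by
  rw [aeval_eq_sum_range (p := P), reciprocal, map_sum, Finset.mul_sum,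
    ← Finset.sum_range_reflect (fun i => x ^ P.natDegree * (P.coeff i • (q / x) ^ i))]
  refine Finset.sum_congr rfl fun i hi => ?_
  have hi' : i ≤ P.natDegree := Nat.lt_succ_iff.1 (Finset.mem_range.1 hi)
  have h1 : P.natDegree + 1 - 1 - i = P.natDegree - i := by lia
  have h2 : x ^ P.natDegree = x ^ i * x ^ (P.natDegree - i) := by
    rw [← pow_add, Nat.add_sub_cancel' hi']
  rw [h1, div_pow, zsmul_eq_mul, h2, map_mul, aeval_C, map_pow, aeval_X, algebraMap_int_eq,
    eq_intCast]
  push_cast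
  have := pow_ne_zero (P.natDegree - i) hx
  field_simp

section Symmetry

variable {q : ℕ} {c : WeilClass q} (hc : ¬ c.IsRational) {s : ℤ} (hs : s ^ 2 = (q : ℤ)) (hq : 0 < q)

include hc hs hq

/-- The complex conjugate `q / π` of `π` is a root of `P`, so `x ^ N P(q / x)` is a constant multiple
of `P`. The constant is found by evaluating at `s` and at `-s`, the fixed points of
`x ↦ q / x`. -/
theorem WeilClass.reciprocal_minpoly {t : ℤ} (ht : t ^ 2 = (q : ℤ)) :
    reciprocal q c.minpoly = C (t ^ c.minpoly.natDegree) * c.minpoly := by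
  have hdvd : c.minpoly ∣ reciprocal q c.minpoly := by
    rw [← c.aeval_rep_eq_zero_iff, aeval_reciprocal q _ (c.rep_ne_zero hq),
      c.aeval_div_rep_minpoly hq, mul_zero]
  obtain ⟨u, hu⟩ := hdvd
  have hu0 : u.natDegree = 0 := by
    by_cases h0 : u = 0
    · rw [h0, natDegree_zero]
    · have h1 := natDegree_reciprocal_le q c.minpoly
      rw [hu, c.monic_minpoly.natDegree_mul' h0] at h1
      lia
  obtain ⟨k, rfl⟩ := natDegree_eq_zero.1 hu0
  have ht0 : (t : ℂ) ≠ 0 := by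
    intro h
    rw [Int.cast_eq_zero] at h
    rw [h] at ht
    simp at ht
    lia
  have h2 := aeval_reciprocal q c.minpoly ht0
  have h3 : (q / t : ℂ) = t := by
    rw [div_eq_iff ht0, ← sq]
    exact_mod_cast ht.symm
  have h4 (g : ℤ[X]) : aeval (t : ℂ) g = ((g.eval t : ℤ) : ℂ) := by
    simpa using aeval_algebraMap_apply ℂ t g
  rw [h3, h4, h4, hu, eval_mul, eval_C] at h2
  have h5 : c.minpoly.eval t * k = t ^ c.minpoly.natDegree * c.minpoly.eval t := by
    exact_mod_cast h2
  have h6 : k = t ^ c.minpoly.natDegree :=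
    mul_left_cancel₀ (WeilClass.eval_minpoly_ne_zero hc t) (h5.trans (mul_comm _ _))
  rw [hu, h6, mul_comm]

theorem WeilClass.natDegree_minpoly_eq :
    c.minpoly.natDegree = 2 * (c.minpoly.natDegree / 2) := by
  have h1 := WeilClass.reciprocal_minpoly hc hs hq hs
  have h2 := WeilClass.reciprocal_minpoly hc hs hq (t := -s) (by rw [neg_sq, hs])
  have h3 : s ^ c.minpoly.natDegree = (-s) ^ c.minpoly.natDegree :=
    C_injective (mul_right_cancel₀ c.monic_minpoly.ne_zero (h1.symm.trans h2))
  have hs0 : s ≠ 0 := by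
    rintro rfl
    simp at hs
    lia
  rcases Nat.even_or_odd c.minpoly.natDegree with h | h
  · exact (Nat.two_mul_div_two_of_even h).symm
  · rw [h.neg_pow, self_eq_neg] at h3
    exact absurd h3 (pow_ne_zero _ hs0)

theorem WeilClass.coeff_minpoly_sub {r : ℕ} (hr : r ≤ c.minpoly.natDegree / 2) :
    c.minpoly.coeff (c.minpoly.natDegree / 2 - r) =
      q ^ r * c.minpoly.coeff (c.minpoly.natDegree / 2 + r) := by
  have hN := WeilClass.natDegree_minpoly_eq hc hs hq
  have h1 := congrArg (fun g : ℤ[X] => g.coeff (c.minpoly.natDegree / 2 + r))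
    (WeilClass.reciprocal_minpoly hc hs hq hs)
  simp only [coeff_C_mul] at h1
  generalize c.minpoly.natDegree / 2 = d at *
  rw [coeff_reciprocal q _ (by lia), hN, pow_mul, hs, show 2 * d - (d + r) = d - r by lia] at h1
  have hq0 : (q : ℤ) ^ (d - r) ≠ 0 := pow_ne_zero _ (by lia)
  refine mul_right_cancel₀ hq0 (h1.trans ?_)
  rw [← Nat.sub_add_cancel hr, pow_add, Nat.add_sub_cancel, Nat.sub_add_cancel hr]
  ring

/-- `F ^ d h_π(F, V) = P_π(F)` whenever `F V = q`. -/
theorem WeilClass.pow_mul_aeval_symmPoly {B : Type*} [CommRing B] {f v : B} (hfv : f * v = q) :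
    f ^ (c.minpoly.natDegree / 2) * MvPolynomial.aeval ![f, v] c.symmPoly = aeval f c.minpoly := by
  have hN := WeilClass.natDegree_minpoly_eq hc hs hq
  have hcoeff := fun r => WeilClass.coeff_minpoly_sub hc hs hq (r := r)
  rw [WeilClass.symmPoly, if_neg (WeilClass.im_rep_ne_zero hc hs),
    aeval_eq_sum_range (p := c.minpoly)]
  generalize c.minpoly.natDegree / 2 = d at *
  rw [hN]
  simp only [map_add, map_sum, map_mul, map_pow, MvPolynomial.aeval_C, F, V, MvPolynomial.aeval_X,
    Matrix.cons_val_zero, Matrix.cons_val_one]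
  have hsplit (G : ℕ → B) : ∑ i ∈ Finset.range (2 * d + 1), G i =
      G d + ∑ r ∈ Finset.Icc 1 d, (G (d + r) + G (d - r)) := by
    have h1 : Finset.Icc 1 d = Finset.Ico (0 + 1) (d + 1) := rfl
    rw [h1, ← Finset.sum_Ico_add', Finset.sum_add_distrib, show 2 * d + 1 = d + (1 + d) by lia,
      Finset.sum_range_add, Finset.sum_range_add, Finset.range_one, Finset.sum_singleton, add_zero,
      Finset.range_eq_Ico, ← Finset.range_eq_Ico, ← Finset.sum_range_reflect G d]
    have h2 : ∀ r ∈ Finset.range d, G (d - 1 - r) = G (d - (r + 1)) := fun r _ => by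
      congr 1; lia
    rw [Finset.sum_congr rfl h2, Finset.sum_congr rfl
      (fun r _ => by rw [add_comm 1 r] : ∀ r ∈ Finset.range d, G (d + (1 + r)) = G (d + (r + 1)))]
    ring
  rw [hsplit, mul_add, Finset.mul_sum]
  congr 1
  · rw [zsmul_eq_mul, mul_comm]; rfl
  · refine Finset.sum_congr rfl fun r hr => ?_
    have hr' : r ≤ d := (Finset.mem_Icc.1 hr).2
    have h1 : f ^ d * v ^ r = q ^ r * f ^ (d - r) := by
      rw [← hfv, mul_pow, ← Nat.sub_add_cancel hr', pow_add, Nat.add_sub_cancel]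
      ring
    rw [hcoeff r hr', zsmul_eq_mul, zsmul_eq_mul, pow_add]
    push_cast
    simp only [algebraMap_int_eq, eq_intCast]
    linear_combination (c.minpoly.coeff (d + r) : B) * h1

end Symmetry

/-! ### The defining relations of the minimal central order -/

section Window

variable {B : Type*} [CommRing B] {q : ℕ} {f v : B}

/-- The span of `1, f, …, f ^ k` and `v, …, v ^ k`: the image of the Laurent polynomials of degree at
most `k` on both sides. -/
def window (f v : B) (k : ℕ) : Submodule ℤ B :=
  Submodule.span ℤ {x | ∃ i ≤ k, x = f ^ i ∨ x = v ^ i}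

theorem pow_left_mem_window {i k : ℕ} (h : i ≤ k) : f ^ i ∈ window f v k :=
  Submodule.subset_span ⟨i, h, Or.inl rfl⟩

theorem pow_right_mem_window {i k : ℕ} (h : i ≤ k) : v ^ i ∈ window f v k :=
  Submodule.subset_span ⟨i, h, Or.inr rfl⟩

theorem intCast_mem_window (a : ℤ) (k : ℕ) : (a : B) ∈ window f v k := by
  have h : a • f ^ 0 ∈ window f v k := (window f v k).smul_mem a (pow_left_mem_window (Nat.zero_le k))
  rwa [pow_zero, zsmul_one] at h

theorem window_mono {j k : ℕ} (h : j ≤ k) : window f v j ≤ window f v k :=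
  Submodule.span_mono fun _ ⟨i, hi, hx⟩ => ⟨i, hi.trans h, hx⟩

theorem intCast_mul_mem_window (a : ℤ) {k : ℕ} {x : B} (hx : x ∈ window f v k) :
    (a : B) * x ∈ window f v k := by
  rw [← zsmul_eq_mul]
  exact Submodule.smul_mem _ a hx

theorem window_swap (k : ℕ) : window v f k = window f v k := by
  simp only [window, or_comm]

theorem pow_mul_pow_mem_window (hfv : f * v = q) {i j k : ℕ} (h : i + j ≤ k) :
    f ^ i * v ^ j ∈ window f v k := by
  rcases le_total j i with hij | hij
  · have h1 : f ^ i * v ^ j = ((q ^ j : ℤ) : B) * f ^ (i - j) := by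
      push_cast
      rw [← hfv, mul_pow]
      nth_rw 1 [← Nat.sub_add_cancel hij]
      rw [pow_add]
      ring
    rw [h1]
    exact intCast_mul_mem_window _ (pow_left_mem_window (by lia))
  · have h1 : f ^ i * v ^ j = ((q ^ i : ℤ) : B) * v ^ (j - i) := by
      push_cast
      rw [← hfv, mul_pow]
      nth_rw 1 [← Nat.sub_add_cancel hij]
      rw [pow_add]
      ring
    rw [h1]
    exact intCast_mul_mem_window _ (pow_right_mem_window (by lia))

theorem mul_mem_window (hfv : f * v = q) {j k : ℕ} {x y : B} (hx : x ∈ window f v j)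
    (hy : y ∈ window f v k) : x * y ∈ window f v (j + k) := by
  have h : window f v j * window f v k ≤ window f v (j + k) := by
    rw [window, window, Submodule.span_mul_span, Submodule.span_le]
    rintro _ ⟨x, ⟨i, hi, hx⟩, y, ⟨l, hl, hy⟩, rfl⟩
    rcases hx with rfl | rfl <;> rcases hy with rfl | rfl <;> simp only [SetLike.mem_coe]
    · rw [← pow_add]; exact pow_left_mem_window (by lia)
    · exact pow_mul_pow_mem_window hfv (by lia)
    · rw [mul_comm]; exact pow_mul_pow_mem_window hfv (by lia)
    · rw [← pow_add]; exact pow_right_mem_window (by lia)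
  exact h (Submodule.mul_mem_mul hx hy)

theorem left_mul_mem_window (hfv : f * v = q) {k : ℕ} {x : B} (hx : x ∈ window f v k) :
    f * x ∈ window f v (k + 1) := by
  have h1 : f ∈ window f v 1 := by simpa using pow_left_mem_window (f := f) (v := v) (le_refl 1)
  exact add_comm 1 k ▸ mul_mem_window hfv h1 hx

/-- `h` looks like `f ^ d + ⋯ + v ^ d`: multiplication by `f` and by `v` produces the leading terms
`f ^ (d + 1)` and `v ^ (d + 1)`. In this form the notion includes `h = 1`, `d = 0`. -/
structure IsBimonic (f v h : B) (d : ℕ) : Prop where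
  mem : h ∈ window f v d
  left : f * h - f ^ (d + 1) ∈ window f v d
  right : v * h - v ^ (d + 1) ∈ window f v d

theorem IsBimonic.swap {h : B} {d : ℕ} (H : IsBimonic f v h d) : IsBimonic v f h d :=
  ⟨by rw [window_swap]; exact H.mem, by rw [window_swap]; exact H.right,
    by rw [window_swap]; exact H.left⟩

theorem IsBimonic.left_mul (hfv : f * v = q) {h h' : B} {d d' : ℕ} (H : IsBimonic f v h d)
    (H' : IsBimonic f v h' d') : f * (h * h') - f ^ (d + d' + 1) ∈ window f v (d + d') := by
  have h1 : f * (h * h') - f ^ (d + d' + 1) =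
      (f * h - f ^ (d + 1)) * h' + f ^ d * (f * h' - f ^ (d' + 1)) := by
    ring
  rw [h1]
  exact add_mem (mul_mem_window hfv H.left H'.mem)
    (mul_mem_window hfv (pow_left_mem_window le_rfl) H'.left)

theorem IsBimonic.mul (hfv : f * v = q) {h h' : B} {d d' : ℕ} (H : IsBimonic f v h d)
    (H' : IsBimonic f v h' d') : IsBimonic f v (h * h') (d + d') := by
  refine ⟨mul_mem_window hfv H.mem H'.mem, H.left_mul hfv H', ?_⟩
  rw [← window_swap]
  exact H.swap.left_mul (mul_comm v f ▸ hfv) H'.swap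

theorem isBimonic_one : IsBimonic f v 1 0 :=
  ⟨by simpa using intCast_mem_window (f := f) (v := v) 1 0, by simp, by simp⟩

/-- As `f v = q`, multiplication by `f` moves the term `v ^ (d + 1)` to `q v ^ d`. -/
theorem isBimonic_of_sub_mem (hfv : f * v = q) {h : B} {d : ℕ}
    (H : h - (f ^ (d + 1) + v ^ (d + 1)) ∈ window f v d) : IsBimonic f v h (d + 1) := by
  refine ⟨?_, ?_, ?_⟩
  · rw [← sub_add_cancel h (f ^ (d + 1) + v ^ (d + 1))]
    exact add_mem (window_mono (Nat.le_succ d) H)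
      (add_mem (pow_left_mem_window le_rfl) (pow_right_mem_window le_rfl))
  · have h1 : f * h - f ^ (d + 1 + 1) =
        f * (h - (f ^ (d + 1) + v ^ (d + 1))) + ((q : ℤ) : B) * v ^ d := by
      push_cast
      rw [← hfv]
      ring
    rw [h1]
    exact add_mem (left_mul_mem_window hfv H)
      (intCast_mul_mem_window _ (pow_right_mem_window (Nat.le_succ d)))
  · have h1 : v * h - v ^ (d + 1 + 1) =
        v * (h - (f ^ (d + 1) + v ^ (d + 1))) + ((q : ℤ) : B) * f ^ d := by
      push_cast
      rw [← hfv]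
      ring
    rw [h1]
    rw [← window_swap] at H ⊢
    exact add_mem (left_mul_mem_window (mul_comm v f ▸ hfv) H)
      (intCast_mul_mem_window _ (pow_right_mem_window (Nat.le_succ d)))

/-- The top power `f ^ d` is the only one whose product with `f` leaves the window, and there
`f ^ (d + 1)` is replaced by means of `f h = s h`. -/
theorem left_mul_mem_window_of_relation (hfv : f * v = q) {h : B} {d : ℕ} {s : ℤ}
    (H : IsBimonic f v h d) (hf : f * h = s * h) {x : B} (hx : x ∈ window f v d) :
    f * x ∈ window f v d := by
  have key (i : ℕ) (hi : i ≤ d) : f * f ^ i ∈ window f v d := by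
    rw [← pow_succ']
    rcases hi.lt_or_eq with h1 | rfl
    · exact pow_left_mem_window h1
    · have h2 := sub_mem (intCast_mul_mem_window s H.mem) H.left
      rwa [hf, sub_sub_cancel] at h2
  induction hx using Submodule.span_induction with
  | mem x hx =>
    obtain ⟨i, hi, rfl | rfl⟩ := hx
    · exact key i hi
    · rcases i with _ | i
      · rw [pow_zero, ← pow_zero f]
        exact key 0 hi
      · rw [pow_succ', ← mul_assoc, hfv]
        have h := intCast_mul_mem_window (f := f) (v := v) (q : ℤ)
          (pow_right_mem_window ((Nat.le_succ i).trans hi))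
        rwa [Int.cast_natCast] at h
  | zero => rw [mul_zero]; exact zero_mem _
  | add x y _ _ hx hy => rw [mul_add]; exact add_mem hx hy
  | smul a x _ hx => rw [mul_smul_comm]; exact Submodule.smul_mem _ a hx

/-- The relations `f v = q`, `h (f - s) = 0` and `h (v - s) = 0` rewrite every polynomial in `f` and
`v` as a combination of `f ^ i` and `v ^ i` with `i ≤ d`. -/
theorem aeval_mem_window (hfv : f * v = q) {h : B} {d : ℕ} {s : ℤ}
    (H : IsBimonic f v h d) (hf : f * h = s * h) (hv : v * h = s * h) (g : ZFV) :
    MvPolynomial.aeval ![f, v] g ∈ window f v d := by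
  induction g using MvPolynomial.induction_on with
  | C a => simpa using intCast_mem_window a d
  | add p q hp hq => rw [map_add]; exact add_mem hp hq
  | mul_X p i hp =>
    rw [map_mul, MvPolynomial.aeval_X, mul_comm]
    fin_cases i
    · exact left_mul_mem_window_of_relation hfv H hf hp
    · rw [← window_swap] at hp ⊢
      exact left_mul_mem_window_of_relation (mul_comm v f ▸ hfv) H.swap hv hp

/-- The monomial `1` is counted among the `f ^ i`, so a window of width `k` has `2 k + 1` generators. -/
theorem exists_sum_of_mem_window {k : ℕ} {x : B} (hx : x ∈ window f v k) :
    ∃ a b : ℕ → ℤ, x = ∑ i ∈ Finset.range (k + 1), (a i : B) * f ^ i +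
      ∑ i ∈ Finset.range k, (b i : B) * v ^ (i + 1) := by
  have key (i : ℕ) (hi : i ≤ k) : ∃ a b : ℕ → ℤ,
      f ^ i = ∑ i ∈ Finset.range (k + 1), (a i : B) * f ^ i +
        ∑ i ∈ Finset.range k, (b i : B) * v ^ (i + 1) := by
    refine ⟨Pi.single i 1, 0, ?_⟩
    rw [Finset.sum_eq_single i]
    · simp
    · intro j _ hj
      simp [Pi.single_eq_of_ne hj]
    · intro h
      exact absurd (Finset.mem_range.2 (Nat.lt_succ_of_le hi)) h
  induction hx using Submodule.span_induction with
  | mem x hx =>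
    obtain ⟨i, hi, rfl | rfl⟩ := hx
    · exact key i hi
    · rcases i with _ | i
      · rw [pow_zero, ← pow_zero f]
        exact key 0 hi
      · refine ⟨0, Pi.single i 1, ?_⟩
        rw [Finset.sum_eq_single (s := Finset.range k) i]
        · simp
        · intro j _ hj
          simp [Pi.single_eq_of_ne hj]
        · intro h
          exact absurd (Finset.mem_range.2 hi) h
  | zero => exact ⟨0, 0, by simp⟩
  | add x y _ _ hx hy =>
    obtain ⟨a, b, rfl⟩ := hx
    obtain ⟨a', b', rfl⟩ := hy
    refine ⟨a + a', b + b', ?_⟩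
    simp only [Pi.add_apply, Int.cast_add, add_mul, Finset.sum_add_distrib]
    ring
  | smul n x _ hx =>
    obtain ⟨a, b, rfl⟩ := hx
    refine ⟨fun i => n * a i, fun i => n * b i, ?_⟩
    simp only [zsmul_eq_mul, mul_add, Finset.mul_sum, Int.cast_mul, mul_assoc]

end Window

section Relations

variable {q : ℕ} {s : ℤ} {v : Finset (WeilClass q)}

theorem WeilClass.isBimonic_symmPoly {c : WeilClass q} (hc : ¬ c.IsRational)
    (hs : s ^ 2 = (q : ℤ)) (hq : 0 < q) {B : Type*} [CommRing B] {f g : B} (hfg : f * g = q) :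
    IsBimonic f g (MvPolynomial.aeval ![f, g] c.symmPoly) (c.minpoly.natDegree / 2) := by
  have hN := WeilClass.natDegree_minpoly_eq hc hs hq
  have hpos := c.natDegree_minpoly_pos
  have hlead : c.minpoly.coeff c.minpoly.natDegree = 1 := c.monic_minpoly
  rw [WeilClass.symmPoly, if_neg (WeilClass.im_rep_ne_zero hc hs)]
  generalize c.minpoly.natDegree / 2 = d at *
  obtain ⟨d, rfl⟩ : ∃ k, d = k + 1 := ⟨d - 1, by lia⟩
  rw [hN, two_mul] at hlead
  refine isBimonic_of_sub_mem hfg ?_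
  rw [Finset.sum_Icc_succ_top (by lia), hlead]
  simp only [map_add, map_sum, map_mul, map_pow, F, V, MvPolynomial.aeval_X,
    Matrix.cons_val_zero, Matrix.cons_val_one, map_one, one_mul, eq_intCast, map_intCast]
  rw [← add_assoc, add_sub_cancel_right]
  refine add_mem (intCast_mem_window _ _) (sum_mem fun r hr => intCast_mul_mem_window _ ?_)
  have hr' := (Finset.mem_Icc.1 hr).2
  exact add_mem (pow_left_mem_window hr') (pow_right_mem_window hr')

/-- Half the degree of the product of the polynomials `P_π` over the classes in `v`. -/
def halfDegree (v : Finset (WeilClass q)) : ℕ := ∑ c ∈ v, c.minpoly.natDegree / 2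

theorem isBimonic_symmPoly (hv : ∀ c ∈ v, ¬ c.IsRational)
    (hs : s ^ 2 = (q : ℤ)) (hq : 0 < q) {B : Type*} [CommRing B] {f g : B} (hfg : f * g = q) :
    IsBimonic f g (MvPolynomial.aeval ![f, g] (symmPoly v)) (halfDegree v) := by
  classical
  induction v using Finset.induction_on with
  | empty => simpa [symmPoly, halfDegree] using isBimonic_one
  | insert c v hcv ih =>
    rw [symmPoly, Finset.prod_insert hcv, halfDegree, Finset.sum_insert hcv, map_mul]
    exact (WeilClass.isBimonic_symmPoly (hv c (Finset.mem_insert_self c v)) hs hq hfg).mul hfg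
      (ih fun c' hc' => hv c' (Finset.mem_insert_of_mem hc'))

/-- The product of the polynomials `P_π` over a finite set of classes. -/
def totalPoly (u : Finset (WeilClass q)) : ℤ[X] := ∏ c ∈ u, c.minpoly

theorem monic_totalPoly (u : Finset (WeilClass q)) : (totalPoly u).Monic :=
  monic_prod_of_monic _ _ fun c _ => c.monic_minpoly

theorem totalPoly_dvd_iff (u : Finset (WeilClass q)) (g : ℤ[X]) :
    totalPoly u ∣ g ↔ ∀ c ∈ u, aeval c.rep g = 0 := by
  refine ⟨fun h c hc => (c.aeval_rep_eq_zero_iff g).2 ((Finset.dvd_prod_of_mem _ hc).trans h),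
    fun h => Finset.prod_dvd_of_isRelPrime (fun c _ c' _ hne => ?_)
      fun c hc => (c.aeval_rep_eq_zero_iff g).1 (h c hc)⟩
  refine c.irreducible_minpoly.isRelPrime_iff_not_dvd.2 fun hdvd => hne ?_
  exact WeilClass.minpoly_injective (eq_of_monic_of_associated c.monic_minpoly c'.monic_minpoly
    (c.irreducible_minpoly.associated_of_dvd c'.irreducible_minpoly hdvd))

theorem natDegree_totalPoly_cons (hv : ∀ c ∈ v, ¬ c.IsRational) (hs : s ^ 2 = (q : ℤ)) (hq : 0 < q)
    (hsv : WeilClass.ofInt s hs ∉ v) :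
    (totalPoly (Finset.cons _ v hsv)).natDegree = 2 * halfDegree v + 1 := by
  have h1 : (WeilClass.ofInt s hs).minpoly = X - C s := by
    rw [WeilClass.minpoly, WeilClass.rep_ofInt]
    simpa using minpoly.eq_X_sub_C_of_algebraMap_inj (B := ℂ) s (algebraMap ℤ ℂ).injective_int
  rw [totalPoly, natDegree_prod_of_monic _ _ fun c _ => c.monic_minpoly, Finset.sum_cons, h1,
    natDegree_X_sub_C, halfDegree, Finset.mul_sum, add_comm]
  congr 1
  exact Finset.sum_congr rfl fun c hc => WeilClass.natDegree_minpoly_eq (hv c hc) hs hq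

theorem ofInt_notMem (hv : ∀ c ∈ v, ¬ c.IsRational) (hs : s ^ 2 = (q : ℤ)) :
    WeilClass.ofInt s hs ∉ v :=
  fun h => hv _ h ⟨s, by rw [WeilClass.rep_ofInt]; simp⟩

theorem aeval_map_X {B : Type*} [CommRing B] (φ : ZFV →+* B) (g : ZFV) :
    MvPolynomial.aeval ![φ F, φ V] g = φ g := by
  have h : (MvPolynomial.aeval ![φ F, φ V] : ZFV →ₐ[ℤ] B).toRingHom = φ :=
    MvPolynomial.ringHom_ext (fun a => by simp) fun i => by
      fin_cases i <;> simp [F, V]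
  exact RingHom.congr_fun h g

theorem toOrder_surjective (w : Set (WeilClass q)) : Function.Surjective (toOrder q w) :=
  Ideal.Quotient.mk_surjective.comp Ideal.Quotient.mk_surjective

/-- An element of `R_w` vanishes if and only if its complex values at all classes in `w` do. -/
theorem toOrder_eq_zero_iff (w : Set (WeilClass q)) (g : ZFV) :
    toOrder q w g = 0 ↔ ∀ c ∈ w, MvPolynomial.aeval ![c.rep, q / c.rep] g = 0 := by
  have h1 : toOrder q w g = 0 ↔ toProd q w (Ideal.Quotient.mk _ g) = 0 := by
    rw [toOrder, RingHom.comp_apply, Ideal.Quotient.eq_zero_iff_mem, RingHom.mem_ker]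
  rw [h1, funext_iff, Subtype.forall]
  refine forall₂_congr fun c hc => ?_
  let E : ZFV →+* ℂ := (algebraMap (IntermediateField.adjoin ℚ {c.rep}) ℂ).comp
    ((Pi.evalRingHom (fun c : w => IntermediateField.adjoin ℚ {c.1.rep}) ⟨c, hc⟩).comp
      ((toProd q w).comp (Ideal.Quotient.mk _)))
  have h2 : E g = MvPolynomial.aeval ![c.rep, q / c.rep] g := by
    rw [← aeval_map_X E]
    have hF : E F = c.rep := by simp [E, toProd, F]
    have hV : E V = q / c.rep := by simp [E, toProd, V]
    rw [hF, hV]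
  rw [← h2]
  exact (map_eq_zero (algebraMap (IntermediateField.adjoin ℚ {c.rep}) ℂ)).symm

/-- The ideal generated by `F V - q`, `h_v (F - s)` and `h_v (V - s)`. -/
abbrev relations (q : ℕ) (s : ℤ) (v : Finset (WeilClass q)) : Ideal ZFV :=
  Ideal.span {F * V - (q : ZFV), symmPoly v * (F - (s : ZFV)), symmPoly v * (V - (s : ZFV))}

theorem aeval_rep_symmPoly {c : WeilClass q} (hcv : c ∈ v) (hv : ∀ c ∈ v, ¬ c.IsRational)
    (hs : s ^ 2 = (q : ℤ)) (hq : 0 < q) :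
    MvPolynomial.aeval ![c.rep, q / c.rep] (symmPoly v) = 0 := by
  rw [symmPoly, map_prod]
  refine Finset.prod_eq_zero hcv ?_
  have h := WeilClass.pow_mul_aeval_symmPoly (hv c hcv) hs hq
    (mul_div_cancel₀ (q : ℂ) (c.rep_ne_zero hq))
  rw [c.aeval_rep_minpoly] at h
  exact (mul_eq_zero.1 h).resolve_left (pow_ne_zero _ (c.rep_ne_zero hq))

/-- The relations span the kernel: they leave `2 D + 1` monomials, where `D = halfDegree v`, and these
are independent over `w` because the product of the `P_π` over `w` has degree `2 D + 1`. -/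
theorem ker_toOrder {w : Set (WeilClass q)} (hv : ∀ c ∈ v, ¬ c.IsRational) (hs : s ^ 2 = (q : ℤ))
    (hq : 0 < q) (hw : w = (v : Set (WeilClass q)) ∪ {WeilClass.ofInt s hs}) :
    RingHom.ker (toOrder q w) = relations q s v := by
  have hle : relations q s v ≤ RingHom.ker (toOrder q w) := by
    rw [Ideal.span_le]
    intro g hg
    rw [SetLike.mem_coe, RingHom.mem_ker, toOrder_eq_zero_iff]
    intro c hc
    have hc0 := c.rep_ne_zero hq
    have hmul : c.rep * (q / c.rep) = q := mul_div_cancel₀ _ hc0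
    rw [hw] at hc
    rcases hg with rfl | rfl | rfl
    · simp [F, V, hmul]
    all_goals
      rw [map_mul]
      rcases hc with hc | rfl
      · rw [aeval_rep_symmPoly hc hv hs hq, zero_mul]
      · rw [WeilClass.rep_ofInt] at hc0 ⊢
        have h1 : (q / s : ℂ) = s := by
          rw [div_eq_iff hc0, ← sq]
          exact_mod_cast hs.symm
        simp [F, V, h1]
  refine le_antisymm (fun g hg => ?_) hle
  set mk := Ideal.Quotient.mk (relations q s v) with hmk
  have hrel {r : ZFV} (hr : r ∈ ({F * V - (q : ZFV), symmPoly v * (F - (s : ZFV)),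
      symmPoly v * (V - (s : ZFV))} : Set ZFV)) : mk r = 0 :=
    Ideal.Quotient.eq_zero_iff_mem.2 (Ideal.subset_span hr)
  have hae := aeval_map_X mk
  have hFV : mk F * mk V = (q : ZFV ⧸ relations q s v) := by
    rw [← map_mul, ← map_natCast mk, ← sub_eq_zero, ← map_sub]
    exact hrel (by simp)
  have hF : mk F * mk (symmPoly v) = s * mk (symmPoly v) := by
    rw [← map_intCast mk, ← map_mul, ← map_mul, ← sub_eq_zero, ← map_sub, ← sub_mul, mul_comm]
    exact hrel (by simp)
  have hV : mk V * mk (symmPoly v) = s * mk (symmPoly v) := by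
    rw [← map_intCast mk, ← map_mul, ← map_mul, ← sub_eq_zero, ← map_sub, ← sub_mul, mul_comm]
    exact hrel (by simp)
  have H := isBimonic_symmPoly hv hs hq hFV
  rw [hae] at H
  have hmem := aeval_mem_window hFV H hF hV g
  rw [hae] at hmem
  obtain ⟨a, b, hab⟩ := exists_sum_of_mem_window hmem
  set D := halfDegree v
  -- `g` is congruent to `∑ a i F ^ i + ∑ b i V ^ (i + 1)`, and all of its values vanish
  have hval (c : WeilClass q) (hc : c ∈ w) :
      ∑ i ∈ Finset.range (D + 1), (a i : ℂ) * c.rep ^ i +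
        ∑ i ∈ Finset.range D, (b i : ℂ) * (q / c.rep) ^ (i + 1) = 0 := by
    have h1 : g - (∑ i ∈ Finset.range (D + 1), (a i : ZFV) * F ^ i +
        ∑ i ∈ Finset.range D, (b i : ZFV) * V ^ (i + 1)) ∈ relations q s v := by
      rw [← Ideal.Quotient.eq_zero_iff_mem, map_sub, sub_eq_zero, ← hmk, hab]
      simp
    have h2 := (toOrder_eq_zero_iff w _).1 (hle h1) c hc
    rw [map_sub, (toOrder_eq_zero_iff w g).1 hg c hc, zero_sub, neg_eq_zero] at h2
    simpa [F, V] using h2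
  -- multiplied by `x ^ D`, the combination becomes the polynomial `G` of degree at most `2 D`
  let G : ℤ[X] := ∑ i ∈ Finset.range (D + 1), C (a i) * X ^ (D + i) +
    ∑ i ∈ Finset.range D, C (b i * q ^ (i + 1)) * X ^ (D - (i + 1))
  have hG (c : WeilClass q) (hc : c ∈ w) : aeval c.rep G = 0 := by
    have hc0 := c.rep_ne_zero hq
    rw [← mul_zero (c.rep ^ D), ← hval c hc, mul_add, Finset.mul_sum, Finset.mul_sum]
    simp only [G, map_add, map_sum]
    congr 1
    · refine Finset.sum_congr rfl fun i _ => ?_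
      simp only [map_mul, map_pow, aeval_X, eq_intCast, map_intCast, pow_add]
      ring
    · refine Finset.sum_congr rfl fun i hi => ?_
      have h1 : c.rep ^ D = c.rep ^ (D - (i + 1)) * c.rep ^ (i + 1) := by
        rw [← pow_add, Nat.sub_add_cancel (Finset.mem_range.1 hi)]
      rw [h1, map_mul, map_pow, aeval_X, aeval_C, algebraMap_int_eq, eq_intCast, div_pow]
      have := pow_ne_zero (i + 1) hc0
      push_cast
      field_simp
  have hsv := ofInt_notMem hv hs
  have hdvd : totalPoly (Finset.cons _ v hsv) ∣ G := by
    rw [totalPoly_dvd_iff]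
    intro c hc
    refine hG c ?_
    rw [hw]
    rcases Finset.mem_cons.1 hc with rfl | hc
    · exact Or.inr rfl
    · exact Or.inl hc
  have hGdeg : G.natDegree ≤ 2 * D := by
    refine (natDegree_add_le _ _).trans (max_le ?_ ?_)
    · exact natDegree_sum_le_of_forall_le _ _ fun i hi => (natDegree_C_mul_X_pow_le _ _).trans (by
        have := Finset.mem_range.1 hi
        lia)
    · exact natDegree_sum_le_of_forall_le _ _ fun i hi =>
        (natDegree_C_mul_X_pow_le _ _).trans (by lia)
  have hG0 : G = 0 := by
    by_contra h0
    have h1 := natDegree_le_of_dvd hdvd h0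
    rw [natDegree_totalPoly_cons hv hs hq] at h1
    lia
  have ha (i : ℕ) (hi : i ∈ Finset.range (D + 1)) : a i = 0 := by
    have h1 := congrArg (fun P : ℤ[X] => P.coeff (D + i)) hG0
    simp only [G, coeff_add, finsetSum_coeff, coeff_C_mul_X_pow, coeff_zero] at h1
    rw [Finset.sum_eq_single i (fun j _ hj => if_neg (by lia)) (fun h => absurd hi h), if_pos rfl,
      Finset.sum_eq_zero (fun j hj => if_neg (by
        have := Finset.mem_range.1 hj
        lia)), add_zero] at h1
    exact h1
  have hb (i : ℕ) (hi : i ∈ Finset.range D) : b i = 0 := by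
    have h1 := congrArg (fun P : ℤ[X] => P.coeff (D - (i + 1))) hG0
    have hi' := Finset.mem_range.1 hi
    simp only [G, coeff_add, finsetSum_coeff, coeff_C_mul_X_pow, coeff_zero] at h1
    rw [Finset.sum_eq_zero (fun j hj => if_neg (by lia)), zero_add,
      Finset.sum_eq_single i (fun j hj hne => if_neg (by
        have := Finset.mem_range.1 hj
        lia)) (fun h => absurd hi h), if_pos rfl] at h1
    exact (mul_eq_zero.1 h1).resolve_right (pow_ne_zero _ (by lia))
  rw [← Ideal.Quotient.eq_zero_iff_mem, ← hmk, hab,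
    Finset.sum_eq_zero (fun i hi => by rw [ha i hi, Int.cast_zero, zero_mul]),
    Finset.sum_eq_zero (fun i hi => by rw [hb i hi, Int.cast_zero, zero_mul]), add_zero]

end Relations

/-! ### Ordinary classes -/

open Classical in
/-- The slope zero part of the Newton polygon: if exactly `k` of the
integral elements `α ∈ s` are not units, then the lowest coefficient of `∏ (x - α)` that is a unit is
the one of `x ^ k`. -/
theorem norm_coeff_prod_X_sub_C {K : Type*} [NormedField K] [IsUltrametricDist K] (s : Finset K)
    (hs : ∀ α ∈ s, ‖α‖ ≤ 1) :
    (∀ j, ‖(∏ α ∈ s, (X - C α)).coeff j‖ ≤ 1) ∧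
    (∀ j < (s.filter (‖·‖ < 1)).card, ‖(∏ α ∈ s, (X - C α)).coeff j‖ < 1) ∧
    ‖(∏ α ∈ s, (X - C α)).coeff (s.filter (‖·‖ < 1)).card‖ = 1 := by
  induction s using Finset.induction_on with
  | empty =>
    refine ⟨fun j => ?_, by simp, by simp⟩
    rw [Finset.prod_empty, coeff_one]
    split_ifs <;> simp
  | insert α s hα ih =>
    obtain ⟨h1, h2, h3⟩ := ih fun β hβ => hs β (Finset.mem_insert_of_mem hβ)
    have hα1 : ‖α‖ ≤ 1 := hs α (Finset.mem_insert_self α s)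
    rw [Finset.prod_insert hα]
    set f := ∏ α ∈ s, (X - C α) with hf
    have hzero : ((X - C α) * f).coeff 0 = -(α * f.coeff 0) := by
      simp [sub_mul, mul_coeff_zero]
    have hsucc (j : ℕ) : ((X - C α) * f).coeff (j + 1) = f.coeff j - α * f.coeff (j + 1) := by
      rw [sub_mul, coeff_sub, coeff_X_mul, coeff_C_mul]
    have hle (j : ℕ) : ‖α * f.coeff j‖ ≤ 1 := by
      rw [norm_mul]
      exact mul_le_one₀ hα1 (norm_nonneg _) (h1 j)
    have hmax (a b : K) : ‖a - b‖ ≤ max ‖a‖ ‖b‖ := by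
      rw [sub_eq_add_neg, ← norm_neg b]
      exact IsUltrametricDist.norm_add_le_max a (-b)
    have heq {a b : K} (h : ‖a‖ ≠ ‖b‖) : ‖a - b‖ = max ‖a‖ ‖b‖ := by
      rw [sub_eq_add_neg, ← norm_neg b]
      exact IsUltrametricDist.norm_add_eq_max_of_norm_ne_norm (by rwa [norm_neg])
    refine ⟨fun j => ?_, ?_⟩
    · rcases j with _ | j
      · rw [hzero, norm_neg]; exact hle 0
      · rw [hsucc]; exact (hmax _ _).trans (max_le (h1 j) (hle _))
    rcases hα1.lt_or_eq with hlt | heq1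
    · have hlt' (j : ℕ) : ‖α * f.coeff j‖ < 1 := by
        rw [norm_mul]
        exact mul_lt_one_of_nonneg_of_lt_one_left (norm_nonneg _) hlt (h1 j)
      rw [Finset.filter_insert, if_pos hlt, Finset.card_insert_of_notMem (by simp [hα])]
      refine ⟨fun j hj => ?_, ?_⟩
      · rcases j with _ | j
        · rw [hzero, norm_neg]; exact hlt' 0
        · rw [hsucc]
          exact (hmax _ _).trans_lt (max_lt (h2 j (Nat.lt_of_succ_lt_succ hj)) (hlt' _))
      · rw [hsucc, heq (by rw [h3]; exact (hlt' _).ne'), h3, max_eq_left (hlt' _).le]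
    · have hnorm (j : ℕ) : ‖α * f.coeff j‖ = ‖f.coeff j‖ := by rw [norm_mul, heq1, one_mul]
      rw [Finset.filter_insert, if_neg (by rw [heq1]; exact lt_irrefl 1)]
      refine ⟨fun j hj => ?_, ?_⟩
      · rcases j with _ | j
        · rw [hzero, norm_neg, hnorm]; exact h2 0 hj
        · rw [hsucc]
          exact (hmax _ _).trans_lt (max_lt (h2 j (Nat.lt_of_succ_lt hj)) (by
            rw [hnorm]; exact h2 _ hj))
      · generalize (s.filter (‖·‖ < 1)).card = k at *
        rcases k with _ | k
        · rw [hzero, norm_neg, hnorm, h3]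
        · have h4 := h2 k (Nat.lt_succ_self k)
          rw [hsucc, heq (by rw [hnorm, h3]; exact h4.ne), hnorm, h3, max_eq_right h4.le]

theorem norm_le_one_of_aeval_eq_zero {K : Type*} [NormedField K] [IsUltrametricDist K] {P : ℤ[X]}
    (hP : P.Monic) {α : K} (h : aeval α P = 0) : ‖α‖ ≤ 1 := by
  by_contra hlt
  rw [not_le] at hlt
  have h1 : α ^ P.natDegree = -∑ i ∈ Finset.range P.natDegree, (P.coeff i : K) * α ^ i := by
    rw [aeval_eq_sum_range, Finset.sum_range_succ, hP.coeff_natDegree, one_smul] at h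
    simp only [zsmul_eq_mul] at h
    exact eq_neg_of_add_eq_zero_right h
  have hpos : 0 < ‖α‖ := one_pos.trans hlt
  have h2 : ‖α ^ P.natDegree‖ < ‖α‖ ^ P.natDegree := by
    rw [h1, norm_neg]
    obtain ⟨i, hi, hle⟩ := IsUltrametricDist.exists_norm_finsetSum_le
      (Finset.range P.natDegree) fun i => (P.coeff i : K) * α ^ i
    rcases (Finset.range P.natDegree).eq_empty_or_nonempty with hempty | hne
    · rw [hempty, Finset.sum_empty, norm_zero]
      exact pow_pos hpos _
    refine hle.trans_lt ?_
    rw [norm_mul, norm_pow]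
    refine lt_of_le_of_lt (mul_le_of_le_one_left (pow_nonneg hpos.le i)
      (IsUltrametricDist.norm_intCast_le_one K _)) ?_
    exact pow_lt_pow_right₀ hlt (Finset.mem_range.1 (hi hne))
  rw [norm_pow] at h2
  exact lt_irrefl _ h2

theorem norm_intCast_padicAlgCl_lt_one_iff (p : ℕ) [Fact p.Prime] (a : ℤ) :
    ‖(a : PadicAlgCl p)‖ < 1 ↔ (p : ℤ) ∣ a := by
  rw [← Padic.norm_intCast_lt_one_iff, ← PadicAlgCl.norm_extends, map_intCast]

open Classical in
/-- By the functional equation `p` divides all coefficients of `P_π` below the middle one, so at least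
half of the roots are not units, and exactly half if and only if `p` does not divide the middle
coefficient. -/
theorem WeilClass.isOrdinary_iff (p : ℕ) [Fact p.Prime] {q : ℕ} (hpq : p ∣ q) (hq : 0 < q)
    {c : WeilClass q} (hc : ¬ c.IsRational) {s : ℤ} (hs : s ^ 2 = (q : ℤ)) :
    c.IsOrdinary p ↔ ¬ (p : ℤ) ∣ c.minpoly.coeff (c.minpoly.natDegree / 2) := by
  set d := c.minpoly.natDegree / 2 with hd
  have hN : c.minpoly.natDegree = 2 * d := WeilClass.natDegree_minpoly_eq hc hs hq
  let K := PadicAlgCl p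
  let f : K[X] := c.minpoly.map (algebraMap ℤ K)
  have hfm : f.Monic := c.monic_minpoly.map _
  have hfdeg : f.natDegree = 2 * d := (c.monic_minpoly.natDegree_map _).trans hN
  have hsep : f.Separable := by
    have h1 : f = (_root_.minpoly ℚ c.rep).map (algebraMap ℚ K) := by
      rw [minpoly.isIntegrallyClosed_eq_field_fractions' ℚ c.isIntegral_rep, Polynomial.map_map,
        ← IsScalarTower.algebraMap_eq]
      rfl
    rw [h1]
    exact (minpoly.irreducible (c.isIntegral_rep.tower_top (A := ℚ))).separable.map
  have hnodup : f.roots.Nodup := nodup_roots hsep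
  let S : Finset K := f.roots.toFinset
  have hprod : f = ∏ α ∈ S, (X - C α) := by
    rw [Finset.prod_eq_multiset_prod, Multiset.toFinset_val, hnodup.dedup]
    exact (IsAlgClosed.splits f).eq_prod_roots_of_monic hfm
  have hScard : S.card = 2 * d := by
    rw [← hfdeg, hprod, natDegree_prod_of_monic _ _ fun α _ => monic_X_sub_C α]
    simp
  have hmem (α : K) : α ∈ S ↔ aeval α c.minpoly = 0 := by
    rw [Multiset.mem_toFinset, mem_roots hfm.ne_zero, IsRoot.def, eval_map_algebraMap]
  have hint (α : K) (hα : α ∈ S) : ‖α‖ ≤ 1 :=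
    norm_le_one_of_aeval_eq_zero c.monic_minpoly ((hmem α).1 hα)
  obtain ⟨-, hlow, hk⟩ := norm_coeff_prod_X_sub_C S hint
  rw [← hprod] at hlow hk
  have hcoeff (j : ℕ) : ‖f.coeff j‖ < 1 ↔ (p : ℤ) ∣ c.minpoly.coeff j := by
    rw [coeff_map, eq_intCast, norm_intCast_padicAlgCl_lt_one_iff]
  have hbelow (j : ℕ) (hj : j < d) : (p : ℤ) ∣ c.minpoly.coeff j := by
    have h1 := WeilClass.coeff_minpoly_sub hc hs hq (r := d - j) (Nat.sub_le _ _)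
    rw [← hd, Nat.sub_sub_self hj.le] at h1
    rw [h1]
    exact ((Int.natCast_dvd_natCast.2 hpq).trans (dvd_pow_self _ (by lia))).mul_right _
  have hset : {α : K | aeval α c.minpoly = 0} = S := by
    ext α
    exact (hmem α).symm
  have hset1 : {α : K | aeval α c.minpoly = 0 ∧ ‖α‖ = 1} = S.filter (¬ ‖·‖ < 1) := by
    ext α
    rw [Finset.coe_filter, Set.mem_ofPred, Set.mem_ofPred, ← hmem]
    exact and_congr_right fun h => by rw [not_lt, le_antisymm_iff, and_iff_right (hint α h)]
  have hsum := Finset.card_filter_add_card_filter_not (s := S) (‖·‖ < 1)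
  rw [WeilClass.IsOrdinary, hset, hset1, Set.ncard_coe_finset, Set.ncard_coe_finset]
  generalize (S.filter (‖·‖ < 1)).card = k at *
  have hdk : d ≤ k := by
    by_contra h
    exact (((hcoeff k).2 (hbelow k (not_le.1 h))).ne) hk
  have hiff : k = d ↔ ¬ (p : ℤ) ∣ c.minpoly.coeff d := by
    rw [← hcoeff]
    refine ⟨fun h => h ▸ hk.not_lt, fun h => ?_⟩
    by_contra hne
    exact h (hlow d (lt_of_le_of_ne hdk (Ne.symm hne)))
  rw [← hiff]
  lia

/-! ### The minimal central order over the integers -/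

section Eval

variable {B : Type*} [CommRing B]

/-- Evaluation of polynomials in `F` and `V` at a point of a commutative ring, with the canonical
`ℤ`-algebra structure. Being stated over a variable ring, its lemmas do not meet the other
`ℤ`-algebra structures that quotients and polynomial rings carry. -/
def evalAt (y : Fin 2 → B) : ZFV →+* B := (MvPolynomial.aeval y : ZFV →ₐ[ℤ] B).toRingHom

@[simp]
theorem evalAt_X (y : Fin 2 → B) (i : Fin 2) : evalAt y (MvPolynomial.X i) = y i :=
  MvPolynomial.aeval_X y i

theorem evalAt_map_X (φ : ZFV →+* B) (G : ZFV) : evalAt ![φ F, φ V] G = φ G := aeval_map_X φ G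

theorem map_evalAt {A : Type*} [CommRing A] (φ : A →+* B) (y : Fin 2 → A) (G : ZFV) :
    φ (evalAt y G) = evalAt (fun i => φ (y i)) G :=
  RingHom.congr_fun (MvPolynomial.ringHom_ext (f := φ.comp (evalAt y)) (by simp) (by simp)) G

theorem evalAt_sub_evalAt_mem {J : Ideal B} {x y : Fin 2 → B} (h : ∀ i, x i - y i ∈ J) (G : ZFV) :
    evalAt x G - evalAt y G ∈ J := by
  rw [← Ideal.Quotient.eq, map_evalAt, map_evalAt]
  congr 2
  funext i
  exact Ideal.Quotient.eq.2 (h i)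

theorem evalAt_zero (G : ZFV) : evalAt (0 : Fin 2 → B) G = (MvPolynomial.constantCoeff G : ℤ) := by
  simp [evalAt, MvPolynomial.aeval_zero]

theorem exists_pow_mul_aeval_eq {q : ℕ} {f g : B} (hfg : f * g = q) (G : ZFV) :
    ∃ (k : ℕ) (P : ℤ[X]), f ^ k * MvPolynomial.aeval ![f, g] G = aeval f P := by
  induction G using MvPolynomial.induction_on with
  | C a => exact ⟨0, C a, by simp⟩
  | add G G' hG hG' =>
    obtain ⟨k, P, h⟩ := hG
    obtain ⟨k', P', h'⟩ := hG'
    refine ⟨k + k', X ^ k' * P + X ^ k * P', ?_⟩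
    simp only [map_add, map_mul, map_pow, aeval_X, ← h, ← h']
    ring
  | mul_X G i hG =>
    obtain ⟨k, P, h⟩ := hG
    fin_cases i
    · refine ⟨k, P * X, ?_⟩
      simp only [map_mul, aeval_X, ← h, MvPolynomial.aeval_X]
      simp [mul_assoc]
    · refine ⟨k + 1, P * (q : ℤ[X]), ?_⟩
      simp only [map_mul, ← h, MvPolynomial.aeval_X, map_natCast, ← hfg]
      simp only [Fin.mk_one, Matrix.cons_val_one, Matrix.cons_val_fin_one]
      ring

theorem aeval_mul_eq_of_relations {f g h : B} {s : ℤ} (hf : f * h = s * h) (hg : g * h = s * h)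
    (G : ZFV) : ∃ a : ℤ, MvPolynomial.aeval ![f, g] G * h = a * h := by
  induction G using MvPolynomial.induction_on with
  | C a => exact ⟨a, by simp⟩
  | add G G' hG hG' =>
    obtain ⟨a, ha⟩ := hG
    obtain ⟨b, hb⟩ := hG'
    exact ⟨a + b, by rw [map_add, add_mul, ha, hb]; push_cast; ring⟩
  | mul_X G i hG =>
    obtain ⟨a, ha⟩ := hG
    refine ⟨a * s, ?_⟩
    have h1 : (![f, g] i) * h = s * h := by fin_cases i <;> assumption
    rw [map_mul, MvPolynomial.aeval_X, mul_assoc, h1, mul_left_comm, ha]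
    push_cast
    ring

end Eval

/-- `τ : ℤ[F, V] → R` identifies `R` with the minimal central order `R_w` for `w = v ∪ {s}`: it is
surjective, and its kernel consists of the polynomials that vanish at all classes in `w`, or, what
amounts to the same, is generated by the relations. -/
structure PresentsOrder {q : ℕ} {s : ℤ} (hs : s ^ 2 = (q : ℤ)) (v : Finset (WeilClass q))
    {R : Type} [CommRing R] (τ : ZFV →+* R) : Prop where
  pos : 0 < q
  nonrational : ∀ c ∈ v, ¬ c.IsRational
  surjective : Function.Surjective τ
  eq_zero_iff : ∀ G, τ G = 0 ↔ ∀ c, c ∈ v ∨ c = WeilClass.ofInt s hs →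
    MvPolynomial.aeval ![c.rep, q / c.rep] G = 0
  ker_eq : RingHom.ker τ = relations q s v

namespace PresentsOrder

variable {q : ℕ} {s : ℤ} {hs : s ^ 2 = (q : ℤ)} {v : Finset (WeilClass q)}
    {R : Type} [CommRing R] {τ : ZFV →+* R} (H : PresentsOrder hs v τ)

include H

theorem relation {r : ZFV} (hr : r ∈ ({F * V - (q : ZFV), symmPoly v * (F - (s : ZFV)),
      symmPoly v * (V - (s : ZFV))} : Set ZFV)) : τ r = 0 := by
  rw [← RingHom.mem_ker, H.ker_eq]
  exact Ideal.subset_span hr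

theorem F_mul_V : τ F * τ V = q := by
  rw [← map_mul, ← map_natCast τ, ← sub_eq_zero, ← map_sub]
  exact H.relation (by simp)

theorem F_mul_symmPoly : τ F * τ (symmPoly v) = s * τ (symmPoly v) := by
  rw [← map_intCast τ, ← map_mul, ← map_mul, ← sub_eq_zero, ← map_sub, ← sub_mul, mul_comm]
  exact H.relation (by simp)

theorem V_mul_symmPoly : τ V * τ (symmPoly v) = s * τ (symmPoly v) := by
  rw [← map_intCast τ, ← map_mul, ← map_mul, ← sub_eq_zero, ← map_sub, ← sub_mul, mul_comm]
  exact H.relation (by simp)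

theorem eq_zero_of_intCast_mul_eq_zero {a : ℤ} {r : R} (h : a * r = 0) : a = 0 ∨ r = 0 := by
  obtain ⟨G, rfl⟩ := H.surjective r
  by_cases ha : a = 0
  · exact Or.inl ha
  · rw [← map_intCast τ, ← map_mul, H.eq_zero_iff] at h
    refine Or.inr ((H.eq_zero_iff G).2 fun c hc => ?_)
    have h1 := h c hc
    rw [map_mul, map_intCast] at h1
    exact (mul_eq_zero.1 h1).resolve_left (Int.cast_ne_zero.2 ha)

theorem isNoetherianRing : IsNoetherianRing R := isNoetherianRing_of_surjective _ _ τ H.surjective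

theorem finite : Module.Finite ℤ R := by
  have Hm := isBimonic_symmPoly H.nonrational hs H.pos H.F_mul_V
  rw [aeval_map_X] at Hm
  refine ⟨Submodule.fg_def.2 ⟨{x | ∃ i ≤ halfDegree v, x = τ F ^ i ∨ x = τ V ^ i},
    ?_, eq_top_iff.2 fun r _ => ?_⟩⟩
  · refine (((Set.finite_Iic (halfDegree v)).image (τ F ^ ·)).union
      ((Set.finite_Iic (halfDegree v)).image (τ V ^ ·))).subset ?_
    rintro x ⟨i, hi, rfl | rfl⟩
    · exact Or.inl ⟨i, hi, rfl⟩
    · exact Or.inr ⟨i, hi, rfl⟩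
  · obtain ⟨G, rfl⟩ := H.surjective r
    rw [← aeval_map_X τ G]
    exact aeval_mem_window H.F_mul_V Hm H.F_mul_symmPoly H.V_mul_symmPoly G

omit H in
theorem constantCoeff_symmPoly (hv : ∀ c ∈ v, ¬ c.IsRational) (hs : s ^ 2 = (q : ℤ)) :
    MvPolynomial.constantCoeff (symmPoly v) =
      ∏ c ∈ v, c.minpoly.coeff (c.minpoly.natDegree / 2) := by
  rw [symmPoly, map_prod]
  refine Finset.prod_congr rfl fun c hc => ?_
  rw [WeilClass.symmPoly, if_neg (WeilClass.im_rep_ne_zero (hv c hc) hs), map_add,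
    MvPolynomial.constantCoeff_C, map_sum, Finset.sum_eq_zero, add_zero]
  intro r hr
  have hr0 : r ≠ 0 := Nat.one_le_iff_ne_zero.1 (Finset.mem_Icc.1 hr).1
  simp [F, V, hr0]

/-- All classes in `v` are ordinary if and only if `h_v(0, 0)` is prime to `p`. -/
theorem forall_isOrdinary_iff (p : ℕ) [Fact p.Prime] (hpq : p ∣ q) :
    (∀ c ∈ v, c.IsOrdinary p) ↔ ¬ (p : ℤ) ∣ MvPolynomial.constantCoeff (symmPoly v) := by
  have hp : Prime (p : ℤ) := Nat.prime_iff_prime_int.1 Fact.out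
  rw [constantCoeff_symmPoly H.nonrational hs, hp.dvd_finsetProd_iff]
  push Not
  exact forall₂_congr fun c hc => WeilClass.isOrdinary_iff p hpq H.pos (H.nonrational c hc) hs

/-! ### The local rings in the ordinary case -/

omit H in
/-- Away from the vanishing locus of `f`, the ring generated by `f` and `g = q / f` is a localization
of the ring `ℤ[f] = ℤ[x] / (P)`. -/
theorem _root_.WeilNumber.hasInjectiveDimensionLE_one_of_notMem {f g : R} (hfg : f * g = q)
    (hgen : ∀ r, ∃ G : ZFV, MvPolynomial.aeval ![f, g] G = r) {P : ℤ[X]} (hP : P.Monic)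
    (hP0 : 0 < P.natDegree) (hPf : ∀ G : ℤ[X], aeval f G = 0 ↔ P ∣ G) (n : Ideal R) [n.IsPrime]
    (hfn : f ∉ n) : CategoryTheory.HasInjectiveDimensionLE
      (ModuleCat.of (Localization.AtPrime n) (Localization.AtPrime n)) 1 := by
  let j : AdjoinRoot P →+* R := AdjoinRoot.lift (algebraMap ℤ R) f ((hPf P).2 dvd_rfl)
  have hj (G : ℤ[X]) : j (AdjoinRoot.mk P G) = aeval f G := AdjoinRoot.lift_mk _ _
  have hpow (r : R) : ∃ (k : ℕ) (G : ℤ[X]), f ^ k * r = aeval f G := by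
    obtain ⟨G, rfl⟩ := hgen r
    exact exists_pow_mul_aeval_eq hfg G
  have hfk (k : ℕ) : f ^ k ∉ n := fun h => hfn (‹n.IsPrime›.mem_of_pow_mem k h)
  let _ := ((algebraMap R (Localization.AtPrime n)).comp j).toAlgebra
  have hloc : IsLocalization (n.comap j).primeCompl (Localization.AtPrime n) := by
    refine isLocalization_comap_primeCompl j n (fun r => ?_) fun c t ht h => ?_
    · obtain ⟨k, G, hG⟩ := hpow r
      refine ⟨1, (Ideal.ne_top_iff_one n).1 ‹n.IsPrime›.ne_top, AdjoinRoot.mk P G,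
        AdjoinRoot.mk P (X ^ k), ?_, ?_⟩
      · rw [hj, map_pow, aeval_X]; exact hfk k
      · rw [hj, hj, map_pow, aeval_X, hG, sub_self, mul_zero]
    · obtain ⟨G, rfl⟩ := AdjoinRoot.mk_surjective c
      obtain ⟨k, T, hT⟩ := hpow t
      refine ⟨AdjoinRoot.mk P T, ?_, ?_⟩
      · rw [hj, ← hT]
        exact fun hm => (‹n.IsPrime›.mem_or_mem hm).elim (hfk k) ht
      · rw [hj] at h
        rw [← map_mul, AdjoinRoot.mk_eq_zero, ← hPf, map_mul, ← hT, mul_assoc, h, mul_zero]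
  exact hasInjectiveDimensionLE_of_isLocalization (n.comap j).primeCompl 1
    (hasInjectiveDimensionLE_one_adjoinRoot hP hP0)

theorem aeval_F_eq_zero_iff (G : ℤ[X]) :
    aeval (τ F) G = 0 ↔ totalPoly (Finset.cons _ v (ofInt_notMem H.nonrational hs)) ∣ G := by
  rw [show aeval (τ F) G = τ (aeval F G) from aeval_algHom_apply τ.toIntAlgHom F G, H.eq_zero_iff,
    totalPoly_dvd_iff]
  refine forall_congr' fun c => ?_
  rw [← aeval_algHom_apply, MvPolynomial.aeval_X, Finset.mem_cons, or_comm, Matrix.cons_val_zero]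

theorem aeval_V_eq_zero_iff (G : ℤ[X]) :
    aeval (τ V) G = 0 ↔ totalPoly (Finset.cons _ v (ofInt_notMem H.nonrational hs)) ∣ G := by
  rw [show aeval (τ V) G = τ (aeval V G) from aeval_algHom_apply τ.toIntAlgHom V G, H.eq_zero_iff,
    totalPoly_dvd_iff]
  refine forall_congr' fun c => ?_
  rw [← aeval_algHom_apply, MvPolynomial.aeval_X, Finset.mem_cons, or_comm, Matrix.cons_val_one,
    Matrix.cons_val_fin_one, c.aeval_div_rep H.pos, map_eq_zero]

/-- If `p` does not divide `h_v(0, 0)`, every local ring of `R_w` is a localization of `ℤ[x] / (P)`, where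
`P` is the product of the `P_π` over `w`, or of `ℤ`. -/
theorem hasInjectiveDimensionLE_one (p : ℕ) [Fact p.Prime] {e : ℕ} (hq : q = p ^ e)
    (hord : ¬ (p : ℤ) ∣ MvPolynomial.constantCoeff (symmPoly v)) (n : Ideal R) [n.IsPrime] :
    CategoryTheory.HasInjectiveDimensionLE
      (ModuleCat.of (Localization.AtPrime n) (Localization.AtPrime n)) 1 := by
  set P := totalPoly (Finset.cons _ v (ofInt_notMem H.nonrational hs)) with hPdef
  have hP : P.Monic := monic_totalPoly _
  have hP0 : 0 < P.natDegree := by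
    rw [hPdef, natDegree_totalPoly_cons H.nonrational hs H.pos]
    exact Nat.succ_pos _
  have hgen (r : R) : ∃ G : ZFV, MvPolynomial.aeval ![τ F, τ V] G = r := by
    obtain ⟨G, rfl⟩ := H.surjective r
    exact ⟨G, aeval_map_X τ G⟩
  by_cases hF : τ F ∈ n
  swap
  · exact hasInjectiveDimensionLE_one_of_notMem H.F_mul_V hgen hP hP0 H.aeval_F_eq_zero_iff n hF
  by_cases hV : τ V ∈ n
  swap
  · refine hasInjectiveDimensionLE_one_of_notMem (g := τ F) (by rw [mul_comm, H.F_mul_V])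
      (fun r => ?_) hP hP0 H.aeval_V_eq_zero_iff n hV
    obtain ⟨G, rfl⟩ := hgen r
    refine ⟨MvPolynomial.rename (Equiv.swap 0 1) G, ?_⟩
    rw [MvPolynomial.aeval_rename]
    congr 2
    funext i
    fin_cases i <;> simp
  -- here `h_v` is a unit, and the relations make the local ring a localization of `ℤ`
  have hh : τ (symmPoly v) ∉ n := by
    intro hmem
    have h1 : evalAt ![τ F, τ V] (symmPoly v) - evalAt 0 (symmPoly v) ∈ n :=
      evalAt_sub_evalAt_mem (fun i => by fin_cases i <;> simpa) _
    rw [evalAt_map_X, evalAt_zero] at h1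
    have h2 := (n.sub_mem_iff_right hmem).1 h1
    have h3 : ((q : ℤ) : R) ∈ n := by
      rw [Int.cast_natCast, ← H.F_mul_V]
      exact n.mul_mem_right _ hF
    have hp : Prime (p : ℤ) := Nat.prime_iff_prime_int.1 Fact.out
    have hcop : IsCoprime (q : ℤ) (MvPolynomial.constantCoeff (symmPoly v)) := by
      rw [show (q : ℤ) = (p : ℤ) ^ e by rw [hq, Nat.cast_pow]]
      exact (hp.coprime_iff_not_dvd.2 hord).pow_left
    obtain ⟨a, b, hab⟩ := hcop
    refine ‹n.IsPrime›.ne_top ((Ideal.eq_top_iff_one n).2 ?_)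
    have h4 := congrArg (Int.cast : ℤ → R) hab
    rw [Int.cast_add, Int.cast_mul, Int.cast_mul, Int.cast_one] at h4
    rw [← h4]
    exact add_mem (n.mul_mem_left _ h3) (n.mul_mem_left _ h2)
  let j := Int.castRingHom R
  have h1n : (1 : R) ∉ n := (Ideal.ne_top_iff_one n).1 ‹n.IsPrime›.ne_top
  let _ := ((algebraMap R (Localization.AtPrime n)).comp j).toAlgebra
  have hloc : IsLocalization (n.comap j).primeCompl (Localization.AtPrime n) := by
    refine isLocalization_comap_primeCompl j n (fun r => ?_) fun c t ht h => ?_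
    · obtain ⟨G, rfl⟩ := hgen r
      obtain ⟨a, ha⟩ := aeval_mul_eq_of_relations H.F_mul_symmPoly H.V_mul_symmPoly G
      refine ⟨_, hh, a, 1, by rwa [map_one], ?_⟩
      rw [map_one, one_mul, mul_sub, mul_comm, ha, mul_comm, eq_intCast, sub_self]
    · refine ⟨1, by rwa [map_one], ?_⟩
      rw [mul_comm] at h
      have hc : c = 0 := (H.eq_zero_of_intCast_mul_eq_zero h).resolve_right fun h0 =>
        ht (h0 ▸ n.zero_mem)
      rw [hc, mul_zero]
  exact hasInjectiveDimensionLE_of_isLocalization (n.comap j).primeCompl 1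
    hasInjectiveDimensionLE_one_int

end PresentsOrder

/-! ### The singular local ring in the non-ordinary case -/

/-- Modulo `P`, let `y 0 y 1`, `y i H(y)` and `H(0)` vanish. Then the part of `H(y)` that involves only
`y i` is killed by both `y 0` and `y 1`. -/
theorem mul_evalAt_single_mem {B : Type*} [CommRing B] {P : Ideal B} {y : Fin 2 → B} {H : ZFV}
    (hy : y 0 * y 1 ∈ P) (hH : ∀ i, y i * evalAt y H ∈ P)
    (h0 : ((MvPolynomial.constantCoeff H : ℤ) : B) ∈ P) (i j : Fin 2) :
    y j * evalAt (Pi.single i (y i) : Fin 2 → B) H ∈ P := by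
  have hy' {k l : Fin 2} (hkl : k ≠ l) : y k * y l ∈ P := by
    fin_cases k <;> fin_cases l
    · exact absurd rfl hkl
    · exact hy
    · exact mul_comm (y 0) (y 1) ▸ hy
    · exact absurd rfl hkl
  let J (k : Fin 2) : Ideal B := Submodule.comap (LinearMap.mulLeft B (y k)) P
  have hJ (k : Fin 2) (b : B) : b ∈ J k ↔ y k * b ∈ P := Iff.rfl
  rw [← hJ]
  by_cases hij : j = i
  · subst hij
    refine ((J j).sub_mem_iff_right ((hJ j _).2 (hH j))).1
      (evalAt_sub_evalAt_mem (fun k => ?_) H)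
    by_cases hk : k = j
    · subst hk
      rw [Pi.single_eq_same, sub_self]
      exact zero_mem _
    · rw [Pi.single_eq_of_ne hk, sub_zero, hJ]
      exact hy' (Ne.symm hk)
  · have h1 : evalAt (0 : Fin 2 → B) H ∈ J j := by
      rw [evalAt_zero]
      exact P.mul_mem_left _ h0
    refine ((J j).sub_mem_iff_left h1).1 (evalAt_sub_evalAt_mem (fun k => ?_) H)
    rw [Pi.zero_apply, sub_zero]
    by_cases hk : k = i
    · subst hk
      rw [Pi.single_eq_same]
      exact hy' hij
    · rw [Pi.single_eq_of_ne hk]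
      exact zero_mem _

/-- For `v = 0` the window consists of the polynomials of degree at most `k`. -/
theorem coeff_succ_eq_zero_of_mem_window {A : Type*} [CommRing A] {k : ℕ} {P : A[X]}
    (h : P ∈ window (X : A[X]) 0 k) : P.coeff (k + 1) = 0 := by
  induction h using Submodule.span_induction with
  | mem x hx =>
    obtain ⟨i, hi, rfl | rfl⟩ := hx
    · rw [coeff_X_pow, if_neg (by lia)]
    · rcases i with _ | i
      · rw [pow_zero, coeff_one, if_neg (Nat.succ_ne_zero k)]
      · rw [zero_pow (Nat.succ_ne_zero i), coeff_zero]
  | zero => exact coeff_zero _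
  | add x y _ _ hx hy => rw [coeff_add, hx, hy, add_zero]
  | smul a x _ hx => rw [coeff_smul, hx, smul_zero]

namespace PresentsOrder

variable {q : ℕ} {s : ℤ} {hs : s ^ 2 = (q : ℤ)} {v : Finset (WeilClass q)}
    {R : Type} [CommRing R] {τ : ZFV →+* R} (H : PresentsOrder hs v τ)
    (p : ℕ) [Fact p.Prime]

include H

/-- A homomorphism that respects the defining relations factors through `R_w`. -/
theorem exists_factor {T : Type*} [CommRing T] (φ : ZFV →+* T)
    (h : ∀ r ∈ ({F * V - (q : ZFV), symmPoly v * (F - (s : ZFV)),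
      symmPoly v * (V - (s : ZFV))} : Set ZFV), φ r = 0) : ∃ ψ : R →+* T, ∀ G, ψ (τ G) = φ G := by
  have hle : RingHom.ker τ ≤ RingHom.ker φ := by
    rw [H.ker_eq, Ideal.span_le]
    exact h
  exact ⟨τ.liftOfSurjective H.surjective ⟨φ, hle⟩, fun G =>
    RingHom.liftOfRightInverse_comp_apply τ _ _ ⟨φ, hle⟩ G⟩

omit H in
theorem dvd_of_sq_eq (hs : s ^ 2 = (q : ℤ)) (hpq : p ∣ q) : (p : ℤ) ∣ s := by
  have hp : Prime (p : ℤ) := Nat.prime_iff_prime_int.1 Fact.out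
  exact hp.dvd_of_dvd_pow (hs ▸ Int.natCast_dvd_natCast.2 hpq)

/-- Modulo `p`, the product `X h_v(X, 0)` has the leading term `X ^ (D + 1)`, and similarly for
`h_v(0, X)`. -/
theorem symmPoly_single_ne_zero (hpq : p ∣ q) (i : Fin 2) :
    evalAt (Pi.single i (X : (ZMod p)[X])) (symmPoly v) ≠ 0 := by
  have hq0 : ((q : ℕ) : (ZMod p)[X]) = 0 := by
    rw [← map_natCast (C : ZMod p →+* _), (ZMod.natCast_eq_zero_iff q p).2 hpq, map_zero]
  intro h0
  have key (h : X * evalAt (Pi.single i (X : (ZMod p)[X])) (symmPoly v) -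
      X ^ (halfDegree v + 1) ∈ window (X : (ZMod p)[X]) 0 (halfDegree v)) : False := by
    have h1 := coeff_succ_eq_zero_of_mem_window h
    rw [h0, mul_zero, zero_sub, coeff_neg, coeff_X_pow_self, neg_eq_zero] at h1
    exact one_ne_zero h1
  fin_cases i
  · have h1 := (isBimonic_symmPoly H.nonrational hs H.pos
      (f := (X : (ZMod p)[X])) (g := 0) (by rw [mul_zero, hq0])).left
    rw [show (![X, 0] : Fin 2 → (ZMod p)[X]) = Pi.single 0 (X : (ZMod p)[X]) by
      funext i; fin_cases i <;> simp] at h1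
    exact key h1
  · have h1 := (isBimonic_symmPoly H.nonrational hs H.pos
      (f := 0) (g := (X : (ZMod p)[X])) (by rw [zero_mul, hq0])).right
    rw [window_swap] at h1
    rw [show (![0, X] : Fin 2 → (ZMod p)[X]) = Pi.single 1 (X : (ZMod p)[X]) by
      funext i; fin_cases i <;> simp] at h1
    exact key h1

/-- The ring `R_w / (p, y_j)`, for `y = (F, V)` and `j ≠ i`, is `𝔽_p[X] / (X E)` with `E ≠ 0` the
image of `h_v`. Hence `E`, the part of `h_v` that involves only `y_i`, does not become zero in the
localization at `(p, F, V)`, while the part that involves only `y_j` does. -/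
theorem mul_single_notMem (hpq : p ∣ q)
    (h0 : (p : ℤ) ∣ MvPolynomial.constantCoeff (symmPoly v)) {i j : Fin 2} (hij : i ≠ j) (G : ZFV)
    (hG : ¬ (p : ℤ) ∣ MvPolynomial.constantCoeff G) :
    τ G * τ (evalAt (Pi.single i (MvPolynomial.X i) : Fin 2 → ZFV) (symmPoly v)) ∉
      Ideal.span {τ (evalAt (Pi.single j (MvPolynomial.X j) : Fin 2 → ZFV)
        (symmPoly v)), (p : R)} := by
  set E := evalAt (Pi.single i (X : (ZMod p)[X])) (symmPoly v) with hE
  let mk := Ideal.Quotient.mk (Ideal.span {X * E})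
  let φ : ZFV →+* (ZMod p)[X] ⧸ Ideal.span {X * E} :=
    mk.comp (evalAt (Pi.single i (X : (ZMod p)[X])))
  have hφ (G : ZFV) : φ G = mk (evalAt (Pi.single i (X : (ZMod p)[X])) G) := rfl
  have hcast {a : ℤ} (ha : (p : ℤ) ∣ a) : ((a : ℤ) : (ZMod p)[X]) = 0 := by
    rw [← map_intCast (C : ZMod p →+* _), (ZMod.intCast_zmod_eq_zero_iff_dvd a p).2 ha, map_zero]
  have hXE (k : Fin 2) : mk (E * (Pi.single i X : Fin 2 → (ZMod p)[X]) k) = 0 := by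
    by_cases hk : k = i
    · subst hk
      rw [Pi.single_eq_same, Ideal.Quotient.eq_zero_iff_mem, mul_comm]
      exact Ideal.mem_span_singleton_self _
    · rw [Pi.single_eq_of_ne hk, mul_zero, map_zero]
  have hs0 := hcast (dvd_of_sq_eq p hs hpq)
  have hq0 : ((q : ℕ) : (ZMod p)[X]) = 0 := by
    rw [← Int.cast_natCast]
    exact hcast (Int.natCast_dvd_natCast.2 hpq)
  obtain ⟨ψ, hψ⟩ := H.exists_factor φ (by
    rintro r (rfl | rfl | rfl)
    · rw [hφ, map_sub, map_mul, map_natCast, hq0, sub_zero, F, V, evalAt_X,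
        evalAt_X]
      fin_cases i <;> simp
    · rw [hφ, map_mul, map_sub, map_intCast, hs0, sub_zero, F, evalAt_X]
      exact hXE 0
    · rw [hφ, map_mul, map_sub, map_intCast, hs0, sub_zero, V, evalAt_X]
      exact hXE 1)
  have hsingle (k : Fin 2) : ψ (τ (evalAt
      (Pi.single k (MvPolynomial.X k) : Fin 2 → ZFV) (symmPoly v))) =
      mk (evalAt (Pi.single k ((Pi.single i X : Fin 2 → (ZMod p)[X]) k))
        (symmPoly v)) := by
    rw [hψ, hφ, map_evalAt (evalAt (Pi.single i (X : (ZMod p)[X])))]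
    congr 3
    funext l
    by_cases hl : l = k
    · subst hl
      rw [Pi.single_eq_same, Pi.single_eq_same, evalAt_X]
    · rw [Pi.single_eq_of_ne hl, Pi.single_eq_of_ne hl, map_zero]
  intro hmem
  have h1 := Ideal.mem_map_of_mem ψ hmem
  rw [Ideal.map_span, Set.image_pair, hsingle, Pi.single_eq_of_ne hij.symm, Pi.single_zero,
    evalAt_zero, hcast h0, map_zero, map_natCast,
    ← map_natCast mk, ← Int.cast_natCast, hcast dvd_rfl, map_zero, Set.pair_eq_singleton,
    Ideal.span_singleton_eq_bot.2 rfl, Ideal.mem_bot, map_mul, hsingle, Pi.single_eq_same, ← hE,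
    hψ, hφ, ← map_mul, Ideal.Quotient.eq_zero_iff_mem, Ideal.mem_span_singleton] at h1
  have h2 : X ∣ evalAt (Pi.single i (X : (ZMod p)[X])) G :=
    (mul_dvd_mul_iff_right (H.symmPoly_single_ne_zero p hpq i)).1 h1
  have h3 := evalAt_sub_evalAt_mem (J := Ideal.span {(X : (ZMod p)[X])})
    (x := Pi.single i (X : (ZMod p)[X])) (y := 0) (fun k => by
      by_cases hk : k = i
      · subst hk
        simp
      · simp [Pi.single_eq_of_ne hk]) G
  rw [sub_mem_comm_iff] at h3
  have h4 := ((Ideal.span {(X : (ZMod p)[X])}).sub_mem_iff_left (Ideal.mem_span_singleton.2 h2)).1 h3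
  rw [evalAt_zero, Ideal.mem_span_singleton, X_dvd_iff, ← map_intCast (C : ZMod p →+* _), coeff_C_zero,
    ZMod.intCast_zmod_eq_zero_iff_dvd] at h4
  exact hG h4

/-- If `p` divides `h_v(0, 0)`, the local ring of `R_w` at `(p, F, V)` is one-dimensional, and modulo
`p` the parts of `h_v` that involve only `F` and only `V` are independent socle elements. So this
local ring does not have finite injective dimension. -/
theorem exists_not_hasInjectiveDimensionLE (hpq : p ∣ q)
    (h0 : (p : ℤ) ∣ MvPolynomial.constantCoeff (symmPoly v)) :
    ∃ (m : Ideal R) (_ : m.IsMaximal), ∀ n : ℕ, ¬ CategoryTheory.HasInjectiveDimensionLE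
      (ModuleCat.of (Localization.AtPrime m) (Localization.AtPrime m)) n := by
  obtain ⟨ε, hε⟩ := H.exists_factor ((Int.castRingHom (ZMod p)).comp MvPolynomial.constantCoeff) (by
    have h1 := (ZMod.natCast_eq_zero_iff q p).2 hpq
    have h2 := (ZMod.intCast_zmod_eq_zero_iff_dvd _ p).2 h0
    rintro r (rfl | rfl | rfl)
    · simp [F, V, h1]
    · simp [h2]
    · simp [h2])
  replace hε (G : ZFV) : ε (τ G) = ((MvPolynomial.constantCoeff G : ℤ) : ZMod p) := hε G
  let m := RingHom.ker ε
  have hεs : Function.Surjective ε := fun z => by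
    obtain ⟨a, rfl⟩ := ZMod.intCast_surjective z
    exact ⟨a, map_intCast ε a⟩
  have hm : m.IsMaximal := RingHom.ker_isMaximal_of_surjective ε hεs
  refine ⟨m, hm, fun n hn => ?_⟩
  have hmemm (G : ZFV) : τ G ∈ m ↔ (p : ℤ) ∣ MvPolynomial.constantCoeff G := by
    rw [RingHom.mem_ker, hε, ZMod.intCast_zmod_eq_zero_iff_dvd]
  have hpm : (p : R) ∈ m := by
    rw [RingHom.mem_ker, map_natCast, ZMod.natCast_self]
  have := H.isNoetherianRing
  have := H.finite
  let S := Localization.AtPrime m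
  have hnoeth : IsNoetherianRing S := IsLocalization.isNoetherianRing m.primeCompl S inferInstance
  let x : S := algebraMap R S p
  have hp0 : (p : ℤ) ≠ 0 := Int.natCast_ne_zero.2 (Fact.out : p.Prime).ne_zero
  have hx0 (z : S) (hz : z * x = 0) : z = 0 := by
    obtain ⟨⟨r, t⟩, hr⟩ := IsLocalization.surj m.primeCompl z
    have h1 : algebraMap R S (r * p) = 0 := by
      rw [map_mul, ← hr, mul_right_comm, hz, zero_mul]
    obtain ⟨u, hu⟩ := (IsLocalization.map_eq_zero_iff m.primeCompl S _).1 h1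
    have h2 : (((p : ℕ) : ℤ) : R) * (u * r) = 0 := by
      rw [← hu, Int.cast_natCast]
      ring
    have h3 : algebraMap R S r = 0 := (IsLocalization.map_eq_zero_iff m.primeCompl S r).2
      ⟨u, (H.eq_zero_of_intCast_mul_eq_zero h2).resolve_left hp0⟩
    rw [h3] at hr
    exact (IsLocalization.map_units S t).mul_left_eq_zero.1 hr
  have hxm : x ∈ IsLocalRing.maximalIdeal S :=
    (IsLocalization.AtPrime.to_map_mem_maximal_iff S m (p : R)).2 hpm
  have hx (Q : Ideal S) (hQ : Q.IsPrime) (hxQ : x ∈ Q) : Q = IsLocalRing.maximalIdeal S := by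
    have hQ' : (Q.comap (algebraMap R S)).IsPrime := hQ.comap _
    have hmaxZ : ((Q.comap (algebraMap R S)).comap (algebraMap ℤ R)).IsMaximal := by
      have h1 : (Ideal.span {(p : ℤ)}).IsMaximal :=
        PrincipalIdealRing.isMaximal_of_irreducible
          (Nat.prime_iff_prime_int.1 Fact.out).irreducible
      have h2 : Ideal.span {(p : ℤ)} ≤ (Q.comap (algebraMap R S)).comap (algebraMap ℤ R) := by
        rw [Ideal.span_singleton_le_iff_mem, Ideal.mem_comap, Ideal.mem_comap]
        rwa [algebraMap_int_eq, eq_intCast, Int.cast_natCast]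
      rw [← h1.eq_of_le (Ideal.IsPrime.ne_top inferInstance) h2]
      exact h1
    have hmaxR := Ideal.isMaximal_of_isIntegral_of_isMaximal_comap _ hmaxZ
    have hle : Q.comap (algebraMap R S) ≤ m := by
      intro r hr
      by_contra hrm
      exact hQ.ne_top (Ideal.eq_top_of_isUnit_mem Q hr
        (IsLocalization.map_units S (⟨r, hrm⟩ : m.primeCompl)))
    refine (IsLocalRing.eq_maximalIdeal ?_)
    have h4 := hmaxR.eq_of_le hm.ne_top hle
    have h5 : IsLocalRing.maximalIdeal S ≤ Q := by
      rw [← Localization.AtPrime.map_eq_maximalIdeal, Ideal.map_le_iff_le_comap, h4]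
    rw [← (IsLocalRing.maximalIdeal.isMaximal S).eq_of_le hQ.ne_top h5]
    infer_instance
  let E (i : Fin 2) : R :=
    τ (evalAt (Pi.single i (MvPolynomial.X i) : Fin 2 → ZFV) (symmPoly v))
  -- the elements `E i` are killed by the maximal ideal modulo `p`
  have hsocR (i : Fin 2) (r : R) (hr : r ∈ m) : r * E i ∈ Ideal.span {(p : R)} := by
    have hdvd {a : ℤ} (ha : (p : ℤ) ∣ a) : (a : R) ∈ Ideal.span {(p : R)} := by
      obtain ⟨b, rfl⟩ := ha
      rw [Int.cast_mul, Int.cast_natCast]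
      exact Ideal.mul_mem_right _ _ (Ideal.mem_span_singleton_self _)
    have hsd := hdvd (dvd_of_sq_eq p hs hpq)
    have hkill (j : Fin 2) : ![τ F, τ V] j * E i ∈ Ideal.span {(p : R)} := by
      have h1 : E i = evalAt (Pi.single i (![τ F, τ V] i)) (symmPoly v) := by
        change τ (evalAt _ _) = _
        rw [map_evalAt]
        congr 2
        funext k
        by_cases hk : k = i
        · subst hk
          rw [Pi.single_eq_same, Pi.single_eq_same]
          fin_cases k <;> rfl
        · rw [Pi.single_eq_of_ne hk, Pi.single_eq_of_ne hk, map_zero]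
      rw [h1]
      refine mul_evalAt_single_mem ?_ (fun k => ?_) (hdvd h0) i j
      · change τ F * τ V ∈ _
        have h2 := hdvd (Int.natCast_dvd_natCast.2 hpq)
        rwa [H.F_mul_V, ← Int.cast_natCast (R := R) q]
      · rw [evalAt_map_X]
        have h2 : ![τ F, τ V] k * τ (symmPoly v) = s * τ (symmPoly v) := by
          fin_cases k
          · exact H.F_mul_symmPoly
          · exact H.V_mul_symmPoly
        rw [h2]
        exact Ideal.mul_mem_right _ _ hsd
    obtain ⟨G, rfl⟩ := H.surjective r
    let J : Ideal R := Submodule.comap (LinearMap.mulRight R (E i)) (Ideal.span {(p : R)})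
    change τ G ∈ J
    have h3 : evalAt ![τ F, τ V] G - evalAt 0 G ∈ J := evalAt_sub_evalAt_mem (fun k => by
      rw [Pi.zero_apply, sub_zero]
      exact hkill k) G
    rw [evalAt_map_X, evalAt_zero] at h3
    refine (J.sub_mem_iff_left ?_).1 h3
    exact Ideal.mul_mem_right _ _ (hdvd ((hmemm G).1 hr))
  have hsoc (i : Fin 2) (r : S) (hr : r ∈ IsLocalRing.maximalIdeal S) :
      r * algebraMap R S (E i) ∈ Ideal.span {x} := by
    rw [← Localization.AtPrime.map_eq_maximalIdeal] at hr
    have h1 : Ideal.span {x} = (Ideal.span {(p : R)}).map (algebraMap R S) := by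
      rw [Ideal.map_span, Set.image_singleton]
    have h2 : m.map (algebraMap R S) ≤
        Submodule.comap (LinearMap.mulRight S (algebraMap R S (E i))) (Ideal.span {x}) := by
      refine Ideal.map_le_iff_le_comap.2 fun r hr => ?_
      change algebraMap R S r * algebraMap R S (E i) ∈ Ideal.span {x}
      rw [h1, ← map_mul]
      exact Ideal.mem_map_of_mem _ (hsocR i r hr)
    exact h2 hr
  have hindep {i j : Fin 2} (hij : i ≠ j) :
      algebraMap R S (E i) ∉ Ideal.span {algebraMap R S (E j), x} := by
    have h1 : Ideal.span {algebraMap R S (E j), x} =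
        (Ideal.span {E j, (p : R)}).map (algebraMap R S) := by
      rw [Ideal.map_span, Set.image_pair]
    rw [h1, IsLocalization.algebraMap_mem_map_algebraMap_iff m.primeCompl S]
    rintro ⟨t, ht, hmem⟩
    obtain ⟨G, rfl⟩ := H.surjective t
    exact H.mul_single_notMem p hpq h0 hij G (fun h => ht ((hmemm G).2 h)) hmem
  refine hindep one_ne_zero (mem_span_pair_of_ext_one_subsingleton hx0 (fun h => ?_) (hsoc 1)
    (ext_one_subsingleton_of_hasInjectiveDimensionLE hx0 hxm hx hn _
      (Ideal.subset_span (by simp))))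
  exact hindep zero_ne_one (Ideal.span_mono (by simp) h)

/-! ### The presentation and the Gorenstein criterion -/

theorem isGorenstein_iff (hpq : p ∣ q) {e : ℕ} (hq : q = p ^ e) :
    IsGorenstein R ↔ ∀ c ∈ v, c.IsOrdinary p := by
  rw [H.forall_isOrdinary_iff p hpq]
  refine ⟨fun hG h0 => ?_, fun h0 =>
    ⟨H.isNoetherianRing, fun m _ => ⟨1, H.hasInjectiveDimensionLE_one p hq h0 m⟩⟩⟩
  obtain ⟨m, hm, hinf⟩ := H.exists_not_hasInjectiveDimensionLE p hpq h0
  obtain ⟨n, hn⟩ := hG.2 m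
  exact hinf n hn

theorem exists_ringEquiv : ∃ φ : ZFV ⧸ relations q s v ≃+* R,
    ∀ g, φ (Ideal.Quotient.mk _ g) = τ g :=
  ⟨(Ideal.quotEquivOfEq H.ker_eq.symm).trans (RingHom.quotientKerEquivOfSurjective H.surjective),
    fun _ => rfl⟩

end PresentsOrder

end WeilNumber
end

theorem mainTheorem7 (p : ℕ) [Fact p.Prime] (e : ℕ) (he : 0 < e) (q : ℕ) (hq : q = p ^ e)
    (s : ℤ) (hs : s ^ 2 = (q : ℤ))
    (v : Finset (WeilNumber.WeilClass q)) (hv : ∀ c ∈ v, ¬ c.IsRational)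
    (w : Set (WeilNumber.WeilClass q))
    (hw : w = (v : Set (WeilNumber.WeilClass q)) ∪ {WeilNumber.WeilClass.ofInt s hs}) :
    (∃ φ : (WeilNumber.ZFV ⧸ (Ideal.span
          {WeilNumber.F * WeilNumber.V - (q : WeilNumber.ZFV),
            WeilNumber.symmPoly v * (WeilNumber.F - (s : WeilNumber.ZFV)),
            WeilNumber.symmPoly v * (WeilNumber.V - (s : WeilNumber.ZFV))} :
              Ideal WeilNumber.ZFV)) ≃+*
        WeilNumber.MinimalCentralOrder q w,
      ∀ g : WeilNumber.ZFV, φ (Ideal.Quotient.mk _ g) = WeilNumber.toOrder q w g) ∧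
    (WeilNumber.IsGorenstein (WeilNumber.MinimalCentralOrder q w) ↔
      ∀ c ∈ v, c.IsOrdinary p) := by
  have hq0 : 0 < q := hq ▸ pow_pos (Fact.out : p.Prime).pos e
  have hpq : p ∣ q := hq ▸ dvd_pow_self p he.ne'
  have H : WeilNumber.PresentsOrder (R := WeilNumber.MinimalCentralOrder q w) hs v
      (WeilNumber.toOrder q w) :=
    { pos := hq0
      nonrational := hv
      surjective := WeilNumber.toOrder_surjective w
      eq_zero_iff := fun g => by
        rw [WeilNumber.toOrder_eq_zero_iff, hw]
        rfl
      ker_eq := WeilNumber.ker_toOrder hv hs hq0 hw }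
  exact ⟨H.exists_ringEquiv, H.isGorenstein_iff p hpq hq⟩
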